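/- Let $W_{\rm Sp}(x) = 1 - \frac{\sin 2\pi x}{2\pi x}$ for $x \in \mathbb{R}$. For $\Delta > 0$, let $\mathcal{H}_{{\rm Sp},\pi\Delta}$ be the Hilbert space of entire functions $F$ of exponential type at most $\pi\Delta$, i.e. $\limsup_{|z|\to\infty} |z|^{-1}\log|F(z)| \le \pi\Delta$, with $\|F\|^2 = \int_{\mathbb{R}} |F(x)|^2\, W_{\rm Sp}(x)\,dx < \infty$ and inner product $\langle F, H\rangle = \int_{\mathbb{R}} F(x)\overline{H(x)}\,W_{\rm Sp}(x)\,dx$. Let $K = K_{{\rm Sp},\pi\Delta}:\mathbb{C}\times\mathbb{C}\to\mathbb{C}$ be its reproducing kernel, i.e. the unique function such that, for each $w \in \mathbb{C}$, $K(w,\cdot) \in \mathcal{H}_{{\rm Sp},\pi\Delta}$ and $F(w) = \langle F, K(w,\cdot)\rangle$ for all $F \in \mathcal{H}_{{\rm Sp},\pi\Delta}$. (For $0<\Delta\le 2$ such a function exists and is unique.) Quotients below with removable singularities in $z$ or at $w=0$ are understood to be extended by continuity. (i) For $0 < \Delta \le 1$ and all $w, z\in\mathbb{C}$, $$K(w,z)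 = \frac{\sin \pi\Delta(z-\overline{w})}{\pi(z-\overline{w})} + \frac{1}{2-\Delta}\left(\frac{\sin\pi\Delta z}{\pi z}\right)\left(\frac{\sin\pi\Delta\overline{w}}{\pi\overline{w}}\right).$$ (ii) For $1 < \Delta \le 2$, put $$\tau := e^{(2-\Delta)i/4} - i e^{\Delta i/4},$$ $$a := e^{\Delta i/4} - i e^{(2-\Delta)i/4} + i e^{\Delta i/4} - \tfrac{2-\Delta}{4}\tau, \qquad b := e^{\Delta i/4} - i e^{(2-\Delta)i/4} - e^{(2-\Delta)i/4} - \tfrac{2-\Delta}{4}\tau,$$ $$C(w) := \frac{-16\pi^2w^2 + 4\pi i w\, e^{2\pi i w}}{1-16\pi^2w^2}, \qquad F(w) := \frac{2\cos(\pi(2-\Delta)w) + 8\pi w \sin(\pi\Delta w)}{1-16\pi^2w^2},$$ $$G(w) := \frac{2\cos(\pi\Delta w) - 4\pi i w\, e^{-\pi\Delta i w} - e^{\pi(2-\Delta) i w}}{1-16\pi^2w^2} + \frac{\sin(\pi(2-\Delta)w)}{2\pi w(1-16\pi^2w^2)} - \tfrac{2-\Delta}{4}F(w),$$ $$A(w)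 := \frac{\overline{a}\,\overline{G(\overline{w})} - \overline{b}\,G(w)}{\overline{a}b - a\overline{b}}, \quad B(w) := \frac{b\,G(w) - a\,\overline{G(\overline{w})}}{\overline{a}b - a\overline{b}}, \quad D(w) := \tfrac12\big(\tau A(w) + \overline{\tau}B(w) - F(w)\big).$$ Then $\overline{a}b - a\overline{b} \ne 0$ and, for all $z \in \mathbb{C}$ and all $w \in \mathbb{C}\setminus\{\pm\frac{1}{4\pi}\}$, $$\begin{aligned} K(w,z) ={}& \frac{\overline{A(w)}\,(-i e^{2\pi i z}-1)\big(e^{-\Delta(\pi i z + i/4)} - e^{-(2-\Delta)(\pi i z + i/4)}\big)}{2\pi i z + i/2} \\ &+ \frac{\overline{B(w)}\,(i e^{2\pi i z}-1)\big(e^{-\Delta(\pi i z - i/4)} - e^{-(2-\Delta)(\pi i z - i/4)}\big)}{2\pi i z - i/2} \\ &+ \frac{C(\overline{w})\big(e^{\pi\Delta i(z-\overline{w})} - e^{\pi(2-\Delta)i(z-\overline{w})}\big) + \overline{C(w)}\big(-e^{-\pi\Delta i(z-\overline{w})} + e^{-\pi(2-\Delta)i(z-\overline{w})}\big)}{2\pi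 i(z-\overline{w})} \\ &+ \frac{\overline{D(w)}\sin(\pi(2-\Delta)z)}{\pi z} + \frac{\sin(\pi(2-\Delta)(z-\overline{w}))}{\pi(z-\overline{w})}. \end{aligned}$$ Moreover, for each $z$ the function $w \mapsto K(\overline{w},z)$ is entire, and at the points $w_0 = \pm\frac{1}{4\pi}$ the value $K(w_0,z)$ is the limit of the right-hand side as $w \to w_0$, $w\neq w_0$. -/

import Mathlib

open scoped ComplexConjugate Topology

noncomputable section

namespace SpKernel

/-- The symplectic density `W(x) = 1 - sin(2πx)/(2πx)`, extended by continuity to `x = 0`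
(`Real.sinc x = sin x / x` for `x ≠ 0` and `Real.sinc 0 = 1`). -/
def density (x : ℝ) : ℝ := 1 - Real.sinc (2 * Real.pi * x)

/-- The exponential type `limsup_{|z| → ∞} |z|⁻¹ log |F(z)|`, as an extended real number
(with `log 0 = -∞`). -/
def exponentialType (F : ℂ → ℂ) : EReal :=
  Filter.limsup (fun z : ℂ => ENNReal.log ‖F z‖ₑ / ((‖z‖ : ℝ) : EReal)) (Bornology.cobounded ℂ)

/-- The inner product `⟨F, H⟩ = ∫ F(x) conj(H(x)) W(x) dx` over the real line. -/
def innerProd (F H : ℂ → ℂ) : ℂ :=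
  ∫ x : ℝ, F (x : ℂ) * conj (H (x : ℂ)) * (density x : ℂ)

/-- The space of entire functions of exponential type at most `πΔ` that are square integrable
on the real line with respect to `W(x) dx`. -/
def space (Δ : ℝ) : Set (ℂ → ℂ) :=
  {F | Differentiable ℂ F ∧ exponentialType F ≤ ((Real.pi * Δ : ℝ) : EReal) ∧
    MeasureTheory.Integrable (fun x : ℝ => ‖F (x : ℂ)‖ ^ 2 * density x)}

/-- `K` is a reproducing kernel of the space: `K(w, ·)` belongs to the space and
`F(w) = ⟨F, K(w, ·)⟩` for every `F` in the space. -/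
def IsReproducingKernel (Δ : ℝ) (K : ℂ → ℂ → ℂ) : Prop :=
  ∀ w : ℂ, K w ∈ space Δ ∧ ∀ F ∈ space Δ, F w = innerProd F (K w)

/-- The entire function `z ↦ sin(πcz)/(πz)`, with its value `c` at `z = 0`. -/
def sincFun (c : ℝ) (z : ℂ) : ℂ :=
  if z = 0 then (c : ℂ) else Complex.sin (Real.pi * c * z) / (Real.pi * z)

/-- The entire function `s ↦ (e^{αs} - e^{βs})/s`, with its value `α - β` at `s = 0`. -/
def expQuot (α β : ℝ) (s : ℂ) : ℂ :=
  if s = 0 then (α : ℂ) - (β : ℂ) else (Complex.exp (α * s) - Complex.exp (β * s)) / s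

/-- The constant `τ`. -/
def tau (Δ : ℝ) : ℂ :=
  Complex.exp ((2 - Δ) * Complex.I / 4) - Complex.I * Complex.exp (Δ * Complex.I / 4)

/-- The constant `a`. -/
def constA (Δ : ℝ) : ℂ :=
  Complex.exp (Δ * Complex.I / 4) - Complex.I * Complex.exp ((2 - Δ) * Complex.I / 4)
    + Complex.I * Complex.exp (Δ * Complex.I / 4) - ((2 - Δ) / 4) * tau Δ

/-- The constant `b`. -/
def constB (Δ : ℝ) : ℂ :=
  Complex.exp (Δ * Complex.I / 4) - Complex.I * Complex.exp ((2 - Δ) * Complex.I / 4)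
    - Complex.exp ((2 - Δ) * Complex.I / 4) - ((2 - Δ) / 4) * tau Δ

/-- The denominator `conj(a) b - a conj(b)`. -/
def det (Δ : ℝ) : ℂ :=
  conj (constA Δ) * constB Δ - constA Δ * conj (constB Δ)

/-- The function `C(w)`. -/
def funC (w : ℂ) : ℂ :=
  (-16 * Real.pi ^ 2 * w ^ 2
      + 4 * Real.pi * Complex.I * w * Complex.exp (2 * Real.pi * Complex.I * w))
    / (1 - 16 * Real.pi ^ 2 * w ^ 2)

/-- The function `F(w)`. -/
def funF (Δ : ℝ) (w : ℂ) : ℂ :=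
  (2 * Complex.cos (Real.pi * (2 - Δ) * w)
      + 8 * Real.pi * w * Complex.sin (Real.pi * Δ * w))
    / (1 - 16 * Real.pi ^ 2 * w ^ 2)

/-- The function `G(w)`; here `sin(π(2-Δ)w)/(2πw (1-16π²w²))` is written as
`sincFun (2-Δ) w / (2 (1-16π²w²))`. -/
def funG (Δ : ℝ) (w : ℂ) : ℂ :=
  (2 * Complex.cos (Real.pi * Δ * w)
      - 4 * Real.pi * Complex.I * w * Complex.exp (-(Real.pi * Δ * Complex.I * w))
      - Complex.exp (Real.pi * (2 - Δ) * Complex.I * w))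
    / (1 - 16 * Real.pi ^ 2 * w ^ 2)
  + sincFun (2 - Δ) w / (2 * (1 - 16 * Real.pi ^ 2 * w ^ 2))
  - ((2 - Δ) / 4) * funF Δ w

/-- The function `A(w)`. -/
def funA (Δ : ℝ) (w : ℂ) : ℂ :=
  (conj (constA Δ) * conj (funG Δ (conj w)) - conj (constB Δ) * funG Δ w) / det Δ

/-- The function `B(w)`. -/
def funB (Δ : ℝ) (w : ℂ) : ℂ :=
  (constB Δ * funG Δ w - constA Δ * conj (funG Δ (conj w))) / det Δ

/-- The function `D(w)`. -/
def funD (Δ : ℝ) (w : ℂ) : ℂ :=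
  (1 / 2) * (tau Δ * funA Δ w + conj (tau Δ) * funB Δ w - funF Δ w)

/-- The explicit expression for the kernel when `1 < Δ ≤ 2` and `w ≠ ±1/(4π)`. All quotients
with a removable singularity in `z` are extended by continuity: with `ζ = πiz ± i/4`,
`(e^{-Δζ} - e^{-(2-Δ)ζ})/(2πiz ± i/2)` is `expQuot (-Δ) (-(2-Δ)) ζ / 2`, and with
`s = πi(z - conj w)`, `(e^{Δs} - e^{(2-Δ)s})/(2πi(z - conj w))` is `expQuot Δ (2-Δ) s / 2` and
`(-e^{-Δs} + e^{-(2-Δ)s})/(2πi(z - conj w))` is `expQuot (-(2-Δ)) (-Δ) s / 2`. -/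
def explicitKernel (Δ : ℝ) (w z : ℂ) : ℂ :=
  conj (funA Δ w) * (-Complex.I * Complex.exp (2 * Real.pi * Complex.I * z) - 1)
      * (expQuot (-Δ) (-(2 - Δ)) (Real.pi * Complex.I * z + Complex.I / 4) / 2)
  + conj (funB Δ w) * (Complex.I * Complex.exp (2 * Real.pi * Complex.I * z) - 1)
      * (expQuot (-Δ) (-(2 - Δ)) (Real.pi * Complex.I * z - Complex.I / 4) / 2)
  + (funC (conj w) * (expQuot Δ (2 - Δ) (Real.pi * Complex.I * (z - conj w)) / 2)
      + conj (funC w) * (expQuot (-(2 - Δ)) (-Δ) (Real.pi * Complex.I * (z - conj w)) / 2))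
  + conj (funD Δ w) * sincFun (2 - Δ) z
  + sincFun (2 - Δ) (z - conj w)

end SpKernel

end

open Filter MeasureTheory Set Complex
open scoped ComplexConjugate Topology Real FourierTransform Convolution

noncomputable section

/-! By Paley–Wiener, the space consists of transforms F(z) = ∫ f(t) e^{2πitz} dt of square
integrable f supported in [-Δ/2, Δ/2] (`SpKernel.exists_expTransform_eq`). Multiplication by
sinc(2πx) becomes half the integral over the window [t-1, t+1]. By Parseval, the transform of a
bounded k with this support therefore reproduces values at w as soon as k(t) - ½∫_{t-1}^{t+1} k =
e^{-2πitv} on (-Δ/2, Δ/2), where v = conj w (`SpKernel.mem_space_and_reproduces_of_solution`).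
Finding the kernel means solving this integral equation.

If Δ ≤ 1, every window contains the whole support, so k is the exponential plus a constant, and the
constant is found by integrating. If 1 < Δ ≤ 2, this remains true on the middle interval |t| ≤ 1 -
Δ/2. On the two outer intervals the window loses part of the support at one end, and differentiation
gives a coupled system, L'(t) = ½R(t+1) and R'(t) = -½L(t-1), up to the forcing by the exponential.
Its homogeneous solutions are combinations of e^{±it/2}, and a particular solution is a multiple of
e^{-2πitv} on each side. The constants A, B, D come from matching at ±(1 - Δ/2) and from one
condition on the outer end points (`SpKernel.glue_solves`, `SpKernel.boundary_conditions`). The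
resulting 2×2 determinant is `SpKernel.det`, whose imaginary part is negative.

At v = ±1/(4π) the forcing is resonant, and a particular solution needs a factor linear in t. There
only existence is required: Hermitian symmetry of the inner product makes the kernel unique and
conjugate symmetric, hence entire in conj w, so its values at the two resonant points are limits of
the explicit formula. -/

/-! ### Growth of entire functions of exponential type -/

/-- A bound `‖F z‖ ≤ C e^{τ‖z‖}` for every `τ > σ`. -/
def HasExpGrowth (σ : ℝ) (F : ℂ → ℂ) : Prop :=
  ∀ τ > σ, ∃ C : ℝ, 0 ≤ C ∧ ∀ z, ‖F z‖ ≤ C * Real.exp (τ * ‖z‖)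

theorem hasExpGrowth_of_exponentialType_le {σ : ℝ} {F : ℂ → ℂ} (hF : Continuous F)
    (h : SpKernel.exponentialType F ≤ (σ : EReal)) : HasExpGrowth σ F := by
  intro τ hτ
  have hlt : SpKernel.exponentialType F < (τ : EReal) :=
    h.trans_lt (EReal.coe_lt_coe_iff.2 hτ)
  have hev := eventually_lt_of_limsup_lt hlt
  have hev' : ∀ᶠ z : ℂ in Bornology.cobounded ℂ, ‖F z‖ ≤ Real.exp (τ * ‖z‖) := by
    filter_upwards [hev, Bornology.eventually_ne_cobounded 0] with z hz hz0
    have hpos : 0 < ‖z‖ := norm_pos_iff.2 hz0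
    rw [EReal.div_lt_iff (EReal.coe_pos.2 hpos) (EReal.coe_ne_top _), ← EReal.coe_mul] at hz
    by_cases hFz : F z = 0
    · rw [hFz, norm_zero]; positivity
    · have hn : 0 < ‖F z‖ := norm_pos_iff.2 hFz
      rw [← ofReal_norm, ENNReal.log_ofReal_of_pos hn, EReal.coe_lt_coe_iff] at hz
      exact ((Real.log_lt_iff_lt_exp hn).1 hz).le
  rw [← comap_norm_atTop, eventually_comap, eventually_atTop] at hev'
  obtain ⟨R, hR⟩ := hev'
  obtain ⟨B, hB⟩ := (isCompact_closedBall (0 : ℂ) R).exists_bound_of_continuousOn hF.continuousOn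
  -- The 1 serves ‖z‖ ≥ R. The other term serves the disc, where e^{-τ‖z‖} ≤ e^{|τ||R|} whatever the
  -- signs of τ and R.
  refine ⟨1 + |B| * Real.exp (|τ| * |R|), by positivity, fun z => ?_⟩
  rcases le_total R ‖z‖ with hz | hz
  · refine (hR _ hz z rfl).trans ?_
    have : 0 ≤ |B| * Real.exp (|τ| * |R|) := by positivity
    nlinarith [Real.exp_pos (τ * ‖z‖)]
  · have h1 : ‖F z‖ ≤ |B| := (hB z (by simpa using hz)).trans (le_abs_self _)
    have h2 : 1 ≤ Real.exp (|τ| * |R|) * Real.exp (τ * ‖z‖) := by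
      rw [← Real.exp_add]
      apply Real.one_le_exp
      have : -(|τ| * ‖z‖) ≤ τ * ‖z‖ := by
        nlinarith [neg_abs_le τ, norm_nonneg z]
      nlinarith [abs_nonneg τ, le_abs_self R]
    calc ‖F z‖ ≤ |B| * 1 := by simpa using h1
      _ ≤ |B| * (Real.exp (|τ| * |R|) * Real.exp (τ * ‖z‖)) := by gcongr
      _ ≤ _ := by
        rw [add_mul, mul_assoc]
        have := Real.exp_pos (τ * ‖z‖)
        linarith

theorem exponentialType_le_of_norm_le {σ C : ℝ} {F : ℂ → ℂ}
    (h : ∀ z, ‖F z‖ ≤ C * Real.exp (σ * ‖z‖)) : SpKernel.exponentialType F ≤ (σ : EReal) := by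
  -- A positive constant has a logarithm, and log D / ‖z‖ vanishes at infinity.
  set D : ℝ := max C 1
  have hD : 0 < D := lt_of_lt_of_le one_pos (le_max_right _ _)
  have hlim : Tendsto (fun z : ℂ => ((Real.log D / ‖z‖ + σ : ℝ) : EReal)) (Bornology.cobounded ℂ)
      (𝓝 (σ : EReal)) := by
    refine (continuous_coe_real_ereal.tendsto σ).comp ?_
    have : Tendsto (fun z : ℂ => Real.log D / ‖z‖ + σ) (Bornology.cobounded ℂ) (𝓝 (0 + σ)) :=
      (tendsto_const_nhds.div_atTop tendsto_norm_cobounded_atTop).add tendsto_const_nhds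
    simpa using this
  rw [← hlim.limsup_eq]
  refine limsup_le_limsup ?_
  filter_upwards [Bornology.eventually_ne_cobounded 0] with z hz0
  have hpos : 0 < ‖z‖ := norm_pos_iff.2 hz0
  refine (EReal.div_le_iff_le_mul (EReal.coe_pos.2 hpos) (EReal.coe_ne_top _)).2 ?_
  rw [← EReal.coe_mul]
  by_cases hFz : F z = 0
  · simp [hFz]
  · have hn : 0 < ‖F z‖ := norm_pos_iff.2 hFz
    rw [← ofReal_norm, ENNReal.log_ofReal_of_pos hn, EReal.coe_le_coe_iff]
    have h1 : ‖F z‖ ≤ D * Real.exp (σ * ‖z‖) :=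
      (h z).trans (by gcongr; exact le_max_left _ _)
    have h2 := Real.log_le_log hn h1
    rw [Real.log_mul hD.ne' (Real.exp_pos _).ne', Real.log_exp] at h2
    calc _ ≤ _ := h2
      _ = _ := by field_simp

theorem HasExpGrowth.comp_neg {σ : ℝ} {F : ℂ → ℂ} (h : HasExpGrowth σ F) :
    HasExpGrowth σ (fun z => F (-z)) := by
  intro τ hτ
  obtain ⟨C, hC, hb⟩ := h τ hτ
  exact ⟨C, hC, fun z => by simpa using hb (-z)⟩

theorem norm_add_I_ge {z : ℂ} (hz : 0 ≤ z.im) : (1 + ‖z‖) / 2 ≤ ‖z + I‖ := by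
  have h1 : 1 ≤ ‖z + I‖ := by
    have := abs_im_le_norm (z + I)
    simp only [add_im, I_im] at this
    linarith [le_abs_self (z.im + 1)]
  have h2 : ‖z‖ ≤ ‖z + I‖ := by
    rw [Complex.norm_def, Complex.norm_def]
    apply Real.sqrt_le_sqrt
    simp only [normSq_apply, add_re, add_im, I_re, I_im]
    nlinarith
  linarith

theorem norm_add_I_le {z : ℂ} : ‖z + I‖ ≤ 1 + ‖z‖ := by
  have := norm_add_le z I
  simp at this
  linarith

/-- Phragmén-Lindelöf in the upper half plane for functions of exponential type growing at most
linearly on the real line. -/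
theorem norm_le_upper_of_hasExpGrowth {σ M : ℝ} {F : ℂ → ℂ}
    (hd : Differentiable ℂ F) (hg : HasExpGrowth σ F)
    (hr : ∀ x : ℝ, ‖F x‖ ≤ M * (1 + |x|)) {z : ℂ} (hz : 0 ≤ z.im) :
    ‖F z‖ ≤ 2 * M * (1 + ‖z‖) * Real.exp (σ * z.im) := by
  -- With z = Iζ the upper half plane becomes the right one. The exponential factor forces decay
  -- along the positive real ζ-axis, because F grows with the smaller rate σ + ε/2; the divisor z +
  -- I absorbs the linear growth on the boundary. The bound 2M does not depend on ε, so ε can tend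
  -- to 0.
  have key : ∀ ε > 0, ∀ ζ : ℂ, 0 ≤ ζ.re →
      ‖F (I * ζ) * cexp (-((σ + ε : ℝ) : ℂ) * ζ) / (I * ζ + I)‖ ≤ 2 * M := by
    intro ε hε ζ hζ
    have hden : ∀ ζ : ℂ, 0 ≤ ζ.re → I * ζ + I ≠ 0 := by
      intro ζ hζ h0
      have := congrArg Complex.im h0
      simp at this
      linarith
    obtain ⟨C, hC, hb⟩ := hg (σ + ε / 2) (by linarith)
    have hbound : ∀ ζ : ℂ, 0 ≤ ζ.re →
        ‖F (I * ζ) * cexp (-((σ + ε : ℝ) : ℂ) * ζ) / (I * ζ + I)‖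
          ≤ 2 * (C * Real.exp ((σ + ε / 2) * ‖ζ‖) * Real.exp (-(σ + ε) * ζ.re)) := by
      intro ζ hζ
      have h1 : (1 : ℝ) / 2 ≤ ‖I * ζ + I‖ := by
        have := norm_add_I_ge (z := I * ζ) (by simpa using hζ)
        have h0 := norm_nonneg (I * ζ)
        linarith
      rw [norm_div, norm_mul, div_le_iff₀ (by linarith), Complex.norm_exp]
      have h2 := hb (I * ζ)
      have h3 : (-((σ + ε : ℝ) : ℂ) * ζ).re = -(σ + ε) * ζ.re := by simp
      rw [h3]
      simp only [norm_mul, norm_I, one_mul] at h2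
      have h4 : 0 ≤ C * Real.exp ((σ + ε / 2) * ‖ζ‖) * Real.exp (-(σ + ε) * ζ.re) := by positivity
      calc _ ≤ C * Real.exp ((σ + ε / 2) * ‖ζ‖) * Real.exp (-(σ + ε) * ζ.re) := by gcongr
        _ ≤ _ := by nlinarith
    refine PhragmenLindelof.right_half_plane_of_tendsto_zero_on_real
      (f := fun ζ => F (I * ζ) * cexp (-((σ + ε : ℝ) : ℂ) * ζ) / (I * ζ + I)) ?_ ?_ ?_ ?_ hζ
    · refine DifferentiableOn.diffContOnCl fun ζ hζ => ?_
      rw [Complex.closure_setOfPred_lt_re] at hζ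
      refine DifferentiableAt.differentiableWithinAt ?_
      refine DifferentiableAt.div ?_ (by fun_prop) (hden ζ hζ)
      refine DifferentiableAt.mul ?_ (by fun_prop)
      exact (hd _).comp ζ (by fun_prop)
    · refine ⟨1, by norm_num, |σ + ε / 2| + |σ + ε|, ?_⟩
      refine Asymptotics.IsBigO.of_bound (2 * C) ?_
      refine eventually_inf_principal.2 (Eventually.of_forall fun ζ hζ => ?_)
      refine (hbound ζ (le_of_lt hζ)).trans ?_
      rw [Real.rpow_one, Real.norm_of_nonneg (Real.exp_pos _).le, mul_assoc C, ← Real.exp_add,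
        mul_assoc]
      gcongr
      have h1 : |ζ.re| ≤ ‖ζ‖ := abs_re_le_norm ζ
      have h2 : -(σ + ε) * ζ.re ≤ |σ + ε| * ‖ζ‖ := by
        calc -(σ + ε) * ζ.re ≤ |-(σ + ε) * ζ.re| := le_abs_self _
          _ = |σ + ε| * |ζ.re| := by rw [abs_mul, abs_neg]
          _ ≤ _ := by gcongr
      have h3 : (σ + ε / 2) * ‖ζ‖ ≤ |σ + ε / 2| * ‖ζ‖ := by gcongr; exact le_abs_self _
      linarith
    · rw [tendsto_zero_iff_norm_tendsto_zero]
      have hlim : Tendsto (fun x : ℝ => 2 * C * Real.exp (-(ε / 2 * x))) atTop (𝓝 (2 * C * 0)) := by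
        refine Tendsto.const_mul _ ?_
        refine Real.tendsto_exp_neg_atTop_nhds_zero.comp ?_
        exact tendsto_id.const_mul_atTop (by positivity)
      rw [mul_zero] at hlim
      refine tendsto_of_tendsto_of_tendsto_of_le_of_le' tendsto_const_nhds hlim
        (Eventually.of_forall fun x => norm_nonneg _) ?_
      filter_upwards [eventually_ge_atTop 0] with x hx
      refine (hbound x (by simpa using hx)).trans (le_of_eq ?_)
      rw [Complex.norm_real, Real.norm_of_nonneg hx, ofReal_re, mul_assoc C, ← Real.exp_add,
        mul_assoc]
      congr 3
      ring
    · intro x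
      have hI : I * (x * I) = ((-x : ℝ) : ℂ) := by
        push_cast; linear_combination (x : ℂ) * I_mul_I
      have hexp : ‖cexp (-((σ + ε : ℝ) : ℂ) * (x * I))‖ = 1 := by
        rw [Complex.norm_exp]; simp
      rw [norm_div, norm_mul, hexp, mul_one, hI]
      have h1 := norm_add_I_ge (z := ((-x : ℝ) : ℂ)) (by simp)
      have h2 := hr (-x)
      rw [Complex.norm_real, Real.norm_eq_abs] at h1
      have h3 := abs_nonneg (-x)
      have hM : 0 ≤ M := by
        have := (norm_nonneg _).trans (hr 0)
        simpa using this
      rw [div_le_iff₀ (by linarith)]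
      calc _ ≤ _ := h2
        _ = 2 * M * ((1 + |-x|) / 2) := by ring
        _ ≤ _ := by gcongr
  have hζ : 0 ≤ (-I * z).re := by simpa using hz
  have hzI : I * (-I * z) = z := by linear_combination (-z) * I_mul_I
  have hpos : 0 < ‖z + I‖ := by
    have := norm_add_I_ge hz
    have h0 := norm_nonneg z
    linarith
  have hM : 0 ≤ M := by
    have := (norm_nonneg _).trans (hr 0)
    simpa using this
  have hε : ∀ ε > 0, ‖F z‖ ≤ 2 * M * ‖z + I‖ * Real.exp ((σ + ε) * z.im) := by
    intro ε hε
    have := key ε hε _ hζ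
    rw [hzI, norm_div, norm_mul, div_le_iff₀ hpos, Complex.norm_exp] at this
    have h3 : (-((σ + ε : ℝ) : ℂ) * (-I * z)).re = -((σ + ε) * z.im) := by simp; ring
    rw [h3, Real.exp_neg, ← div_eq_mul_inv, div_le_iff₀ (Real.exp_pos _)] at this
    exact this
  have hlim : Tendsto (fun ε : ℝ => 2 * M * ‖z + I‖ * Real.exp ((σ + ε) * z.im)) (𝓝[>] 0)
      (𝓝 (2 * M * ‖z + I‖ * Real.exp ((σ + 0) * z.im))) := by
    refine Tendsto.mono_left (Continuous.tendsto ?_ 0) nhdsWithin_le_nhds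
    fun_prop
  rw [add_zero] at hlim
  refine (ge_of_tendsto hlim (eventually_mem_nhdsWithin.mono fun ε h => hε ε h)).trans ?_
  gcongr
  exact norm_add_I_le

theorem norm_le_of_hasExpGrowth {σ M : ℝ} {F : ℂ → ℂ}
    (hd : Differentiable ℂ F) (hg : HasExpGrowth σ F)
    (hr : ∀ x : ℝ, ‖F x‖ ≤ M * (1 + |x|)) (z : ℂ) :
    ‖F z‖ ≤ 2 * M * (1 + ‖z‖) * Real.exp (σ * |z.im|) := by
  rcases le_total 0 z.im with hz | hz
  · rw [abs_of_nonneg hz]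
    exact norm_le_upper_of_hasExpGrowth hd hg hr hz
  · rw [abs_of_nonpos hz]
    have := norm_le_upper_of_hasExpGrowth (F := fun z => F (-z)) (M := M) (z := -z)
      (hd.comp differentiable_neg) hg.comp_neg
      (fun x => by simpa using hr (-x)) (by simpa using hz)
    simpa using this

/-- An entire function of exponential type that is square integrable on the real line grows at
most linearly, up to the exponential factor. -/
theorem exists_norm_le_of_memLp {σ : ℝ} (hσ : 0 ≤ σ) {F : ℂ → ℂ} (hd : Differentiable ℂ F)
    (hg : HasExpGrowth σ F) (hL : MemLp (fun x : ℝ => F x) 2) :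
    ∃ C : ℝ, 0 ≤ C ∧ ∀ z, ‖F z‖ ≤ C * (1 + ‖z‖) * Real.exp (σ * |z.im|) := by
  -- Square integrability gives no direct pointwise bound on F, but it does on a primitive P: since
  -- ‖F‖ ≤ 1 + ‖F‖², P grows at most linearly on ℝ. Phragmén–Lindelöf applies to P, and Cauchy's
  -- estimate on unit circles carries the bound over to F = P'.
  obtain ⟨P, hP0, hP⟩ := hd.isExactOn_univ.with_val_at 0 0
  have hP' : ∀ z, HasDerivAt P (F z) z := fun z => hP z (mem_univ z)
  have hPd : Differentiable ℂ P := fun z => (hP' z).differentiableAt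
  have hsq : Integrable (fun x : ℝ => ‖F x‖ ^ 2) := (memLp_two_iff_integrable_sq_norm
    hL.aestronglyMeasurable).1 hL
  have hFc : Continuous fun x : ℝ => F x := hd.continuous.comp continuous_ofReal
  set M : ℝ := 1 + ∫ x : ℝ, ‖F x‖ ^ 2
  have hI0 : 0 ≤ ∫ x : ℝ, ‖F x‖ ^ 2 := integral_nonneg fun x => by positivity
  have hreal : ∀ x : ℝ, ‖P x‖ ≤ M * (1 + |x|) := by
    intro x
    have hftc : ∫ t in (0 : ℝ)..x, F t = P x := by
      have h := intervalIntegral.integral_eq_sub_of_hasDerivAt (f := fun t : ℝ => P t)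
        (f' := fun t : ℝ => F t) (a := 0) (b := x)
        (fun t _ => (hP' t).comp_ofReal) (hFc.intervalIntegrable _ _)
      simpa [hP0] using h
    rw [← hftc]
    have h1 : ‖∫ t in (0 : ℝ)..x, F t‖ ≤ |∫ t in (0 : ℝ)..x, (1 + ‖F t‖ ^ 2)| := by
      refine intervalIntegral.norm_integral_le_abs_of_norm_le
        (Eventually.of_forall fun t => ?_) ?_
      · nlinarith [sq_nonneg (‖F t‖ - 1)]
      · exact (continuous_const.add (hFc.norm.pow 2)).intervalIntegrable _ _
    have h2 : |∫ t in (0 : ℝ)..x, ‖F t‖ ^ 2| ≤ ∫ t : ℝ, ‖F t‖ ^ 2 := by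
      rw [intervalIntegral.abs_integral_eq_abs_integral_uIoc, abs_of_nonneg
        (integral_nonneg fun t => by positivity)]
      exact setIntegral_le_integral hsq (Eventually.of_forall fun t => by positivity)
    have hi : IntervalIntegrable (fun t : ℝ => ‖F t‖ ^ 2) volume 0 x :=
      (hFc.norm.pow 2).intervalIntegrable _ _
    rw [intervalIntegral.integral_add (by simp) hi] at h1
    have h3 := abs_add_le (∫ t in (0 : ℝ)..x, (1 : ℝ)) (∫ t in (0 : ℝ)..x, ‖F t‖ ^ 2)
    have h4 : |∫ t in (0 : ℝ)..x, (1 : ℝ)| = |x| := by simp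
    have h5 : M * (1 + |x|) = 1 + |x| + (∫ x : ℝ, ‖F x‖ ^ 2) * (1 + |x|) := by simp only [M]; ring
    nlinarith [abs_nonneg x]
  have hPg : HasExpGrowth σ P := by
    intro τ hτ
    -- Integration costs a factor ‖z‖, absorbed by the gap between τ' and τ.
    set τ' := (σ + τ) / 2
    have h1 : σ < τ' := by simp only [τ']; linarith
    have h2 : τ' < τ := by simp only [τ']; linarith
    obtain ⟨C, hC, hb⟩ := hg τ' h1
    refine ⟨C / (τ - τ'), div_nonneg hC (by linarith), fun z => ?_⟩
    have hmv : ‖P z - P 0‖ ≤ C * Real.exp (τ' * ‖z‖) * ‖z - 0‖ := by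
      refine (convex_closedBall (0 : ℂ) ‖z‖).norm_image_sub_le_of_norm_hasDerivWithin_le
        (f' := F) (fun y _ => (hP' y).hasDerivWithinAt) (fun y hy => ?_) (by simp) (by simp)
      refine (hb y).trans ?_
      have : ‖y‖ ≤ ‖z‖ := by simpa using hy
      have hτ' : 0 ≤ τ' := hσ.trans h1.le
      gcongr
    rw [hP0, sub_zero, sub_zero] at hmv
    refine hmv.trans ?_
    have h3 : (τ - τ') * ‖z‖ ≤ Real.exp ((τ - τ') * ‖z‖) :=
      (Real.add_one_le_exp _).trans' (by linarith)
    have h4 : ‖z‖ ≤ Real.exp ((τ - τ') * ‖z‖) / (τ - τ') := by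
      rw [le_div_iff₀ (by linarith)]; linarith
    calc C * Real.exp (τ' * ‖z‖) * ‖z‖
        ≤ C * Real.exp (τ' * ‖z‖) * (Real.exp ((τ - τ') * ‖z‖) / (τ - τ')) := by gcongr
      _ = C / (τ - τ') * (Real.exp (τ' * ‖z‖) * Real.exp ((τ - τ') * ‖z‖)) := by ring
      _ = _ := by rw [← Real.exp_add]; congr 2; ring
  have hPb := norm_le_of_hasExpGrowth hPd hPg hreal
  have hM : 0 ≤ M := by simp only [M]; linarith
  -- On the unit circle about z, |Im| grows by at most 1, whence e^σ; the 4 is the 2 of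
  -- Phragmén–Lindelöf times the 2 in 2 + ‖z‖ ≤ 2(1 + ‖z‖).
  refine ⟨4 * M * Real.exp σ, by positivity, fun z => ?_⟩
  have hcauchy : ‖deriv P z‖ ≤ (2 * M * (2 + ‖z‖) * Real.exp (σ * (|z.im| + 1))) / 1 := by
    refine Complex.norm_deriv_le_of_forall_mem_sphere_norm_le one_pos
      hPd.diffContOnCl fun ζ hζ => ?_
    have h1 : ‖ζ - z‖ = 1 := by simpa [dist_eq_norm] using hζ
    have h2 : ‖ζ‖ ≤ 1 + ‖z‖ := by
      have := norm_add_le (ζ - z) z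
      rw [sub_add_cancel] at this
      linarith
    have h3 : |ζ.im| ≤ |z.im| + 1 := by
      have := abs_im_le_norm (ζ - z)
      rw [sub_im] at this
      have h4 := abs_sub_abs_le_abs_sub ζ.im z.im
      linarith
    refine (hPb ζ).trans ?_
    have : 1 + ‖ζ‖ ≤ 2 + ‖z‖ := by linarith
    gcongr
  rw [(hP' z).deriv, div_one] at hcauchy
  refine hcauchy.trans ?_
  rw [mul_add σ, mul_one, Real.exp_add]
  have : 2 + ‖z‖ ≤ 2 * (1 + ‖z‖) := by linarith [norm_nonneg z]
  calc 2 * M * (2 + ‖z‖) * (Real.exp (σ * |z.im|) * Real.exp σ)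
      ≤ 2 * M * (2 * (1 + ‖z‖)) * (Real.exp (σ * |z.im|) * Real.exp σ) := by gcongr
    _ = _ := by ring

/-! ### Square integrability on the real line -/

namespace SpKernel

theorem continuous_density : Continuous density := by
  unfold density
  have := Real.continuous_sinc
  fun_prop

theorem density_nonneg (x : ℝ) : 0 ≤ density x := by
  unfold density
  linarith [Real.sinc_le_one (2 * π * x)]

theorem density_le_two (x : ℝ) : density x ≤ 2 := by
  unfold density
  linarith [Real.neg_one_le_sinc (2 * π * x)]

theorem half_le_density {x : ℝ} (hx : 1 ≤ |x|) : 1 / 2 ≤ density x := by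
  unfold density
  have hx0 : x ≠ 0 := by rintro rfl; norm_num at hx
  have hpi := Real.pi_gt_three
  have h0 : 2 * π * x ≠ 0 := by positivity
  rw [Real.sinc_of_ne_zero h0]
  have h1 : |Real.sin (2 * π * x) / (2 * π * x)| ≤ 1 / 2 := by
    rw [abs_div, div_le_iff₀ (abs_pos.2 h0), abs_mul, abs_of_pos (by positivity : 0 < 2 * π)]
    nlinarith [Real.abs_sin_le_one (2 * π * x)]
  linarith [le_abs_self (Real.sin (2 * π * x) / (2 * π * x))]

/-- The density degenerates only at the origin, where continuity of F suffices; for |x| ≥ 1 it is at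
least ½. -/
theorem memLp_two_of_integrable_density {F : ℂ → ℂ} (hF : Continuous F)
    (h : Integrable (fun x : ℝ => ‖F x‖ ^ 2 * density x)) : MemLp (fun x : ℝ => F x) 2 := by
  have hFc : Continuous fun x : ℝ => F x := hF.comp continuous_ofReal
  rw [memLp_two_iff_integrable_sq_norm hFc.aestronglyMeasurable]
  have h1 : IntegrableOn (fun x : ℝ => ‖F x‖ ^ 2) (Icc (-1) 1) :=
    (Continuous.continuousOn (by fun_prop)).integrableOn_compact isCompact_Icc
  have h2 : IntegrableOn (fun x : ℝ => ‖F x‖ ^ 2) (Icc (-1) 1)ᶜ := by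
    refine Integrable.mono' (h.const_mul 2).integrableOn
      (by fun_prop) ?_
    refine (ae_restrict_iff' measurableSet_Icc.compl).2 (Eventually.of_forall fun x hx => ?_)
    have hx' : 1 ≤ |x| := by
      by_contra hlt
      exact hx (abs_le.1 (not_le.1 hlt).le)
    rw [Real.norm_of_nonneg (by positivity)]
    nlinarith [half_le_density hx', sq_nonneg ‖F x‖]
  simpa using h1.union h2

theorem integrable_density_of_memLp_two {F : ℂ → ℂ}
    (h : MemLp (fun x : ℝ => F x) 2) : Integrable (fun x : ℝ => ‖F x‖ ^ 2 * density x) := by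
  refine Integrable.mono' (((memLp_two_iff_integrable_sq_norm h.aestronglyMeasurable).1 h).const_mul 2)
    ((h.aestronglyMeasurable.norm.pow 2).mul continuous_density.aestronglyMeasurable)
    (Eventually.of_forall fun x => ?_)
  rw [Real.norm_of_nonneg (mul_nonneg (by positivity) (density_nonneg x))]
  nlinarith [density_le_two x, sq_nonneg ‖F x‖]

end SpKernel

/-! ### Vanishing of integrals over the real line -/

/-- Cauchy's theorem in the upper half plane for functions decaying quadratically. -/
theorem integral_eq_zero_of_upper_decay {C : ℝ} {g : ℂ → ℂ}
    (hd : DifferentiableOn ℂ g {z | 0 ≤ z.im})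
    (hb : ∀ z : ℂ, 0 ≤ z.im → ‖g z‖ ≤ C / (1 + ‖z‖) ^ 2) :
    ∫ x : ℝ, g x = 0 := by
  have hC : 0 ≤ C := by simpa using (norm_nonneg _).trans (hb 0 (by simp))
  have hcont : Continuous fun x : ℝ => g x :=
    hd.continuousOn.comp_continuous continuous_ofReal fun x => by simp
  have hint : Integrable fun x : ℝ => g x := by
    refine Integrable.mono' (integrable_inv_one_add_sq.const_mul C) hcont.aestronglyMeasurable
      (Eventually.of_forall fun x => (hb x (by simp)).trans ?_)
    rw [div_eq_mul_inv, norm_real, Real.norm_eq_abs]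
    gcongr
    nlinarith [abs_nonneg x, sq_abs x]
  have hlim := intervalIntegral_tendsto_integral hint tendsto_neg_atTop_atBot tendsto_id
  have hzero : Tendsto (fun R : ℝ => ∫ x in (-R)..R, g x) atTop (𝓝 0) := by
    -- The other three sides of the rectangle [-R, R] × [0, R] have total length 4R, and the
    -- integrand there is at most C/R².
    refine squeeze_zero_norm' (a := fun R : ℝ => 4 * C / R) ?_
      (tendsto_const_nhds.div_atTop tendsto_id)
    filter_upwards [eventually_gt_atTop 0] with R hR
    have hside : ∀ z : ℂ, 0 ≤ z.im → R ≤ ‖z‖ → ‖g z‖ ≤ C / R ^ 2 := by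
      intro z hz hRz
      refine (hb z hz).trans ?_
      gcongr
      linarith
    have hrect := Complex.integral_boundary_rect_eq_zero_of_differentiableOn g
      ((-R : ℝ) : ℂ) (R + R * I) (hd.mono ?_)
    · simp only [ofReal_re, ofReal_im, ofReal_zero, zero_mul, add_zero, add_re, mul_re, I_re,
        mul_zero, I_im, mul_one, sub_zero, add_im, mul_im, zero_add] at hrect
      have htop : ‖∫ x in (-R)..R, g (x + R * I)‖ ≤ C / R ^ 2 * |R - -R| := by
        refine intervalIntegral.norm_integral_le_of_norm_le_const fun x _ => ?_
        refine hside _ (by simpa using hR.le) ?_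
        have := abs_im_le_norm ((x : ℂ) + R * I)
        simp only [add_im, ofReal_im, mul_im, ofReal_re, I_im, mul_one, I_re, mul_zero, add_zero,
          zero_add] at this
        exact (le_abs_self R).trans this
      have hright : ‖∫ y in (0 : ℝ)..R, g (R + y * I)‖ ≤ C / R ^ 2 * |R - 0| := by
        refine intervalIntegral.norm_integral_le_of_norm_le_const fun y hy => ?_
        rw [uIoc_of_le hR.le] at hy
        refine hside _ (by simpa using hy.1.le) ?_
        have := abs_re_le_norm ((R : ℂ) + y * I)
        simp only [add_re, ofReal_re, mul_re, I_re, mul_zero, ofReal_im, I_im, mul_one,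
          sub_zero, add_zero] at this
        exact (le_abs_self R).trans this
      have hleft : ‖∫ y in (0 : ℝ)..R, g ((-R : ℝ) + y * I)‖ ≤ C / R ^ 2 * |R - 0| := by
        refine intervalIntegral.norm_integral_le_of_norm_le_const fun y hy => ?_
        rw [uIoc_of_le hR.le] at hy
        refine hside _ (by simpa using hy.1.le) ?_
        have := abs_re_le_norm (((-R : ℝ) : ℂ) + y * I)
        simp only [add_re, ofReal_re, mul_re, I_re, mul_zero, ofReal_im, I_im, mul_one,
          sub_zero, add_zero, abs_neg] at this
        exact (le_abs_self R).trans this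
      have heq : ∫ x in (-R)..R, g x = (∫ x in (-R)..R, g (x + R * I))
          - I • (∫ y in (0 : ℝ)..R, g (R + y * I))
          + I • (∫ y in (0 : ℝ)..R, g ((-R : ℝ) + y * I)) := by
        linear_combination hrect
      rw [heq]
      refine (norm_add_le _ _).trans ?_
      refine (add_le_add_left (norm_sub_le _ _) _).trans ?_
      rw [norm_smul, norm_smul, norm_I, one_mul, one_mul]
      have h1 : |R - -R| = 2 * R := by rw [abs_of_nonneg (by linarith)]; ring
      have h2 : |R - 0| = R := by rw [sub_zero, abs_of_pos hR]
      rw [h1] at htop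
      rw [h2] at hright hleft
      calc _ ≤ C / R ^ 2 * (2 * R) + C / R ^ 2 * R + C / R ^ 2 * R := by gcongr
        _ = _ := by field_simp; ring
    · intro z hz
      rw [mem_reProdIm] at hz
      have := hz.2
      simp only [ofReal_im, add_im, mul_im, ofReal_re, I_im, mul_one, I_re, mul_zero, add_zero,
        zero_add] at this
      rw [uIcc_of_le hR.le] at this
      exact this.1
  exact tendsto_nhds_unique hlim hzero

/-- `F(x) e^{iσx}/(x - w)^3` integrates to zero when `F` is of exponential type `σ` and
`Im w < 0`. -/
theorem integral_mul_exp_div_cube_eq_zero {σ C : ℝ} {F : ℂ → ℂ} (hd : Differentiable ℂ F)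
    (hb : ∀ z, ‖F z‖ ≤ C * (1 + ‖z‖) * Real.exp (σ * |z.im|)) {w : ℂ} (hw : w.im < 0) :
    ∫ x : ℝ, F x * cexp (I * σ * x) / (x - w) ^ 3 = 0 := by
  have hC : 0 ≤ C := by simpa using (norm_nonneg _).trans (hb 0)
  have hne : ∀ z : ℂ, 0 ≤ z.im → -w.im ≤ ‖z - w‖ := by
    intro z hz
    have := abs_im_le_norm (z - w)
    rw [sub_im] at this
    linarith [le_abs_self (z.im - w.im)]
  -- Chosen so that 1 + ‖z‖ ≤ κ‖z - w‖ in the closed upper half plane, where ‖z - w‖ ≥ -Im w. Linear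
  -- growth over a cube then leaves quadratic decay.
  set κ : ℝ := 1 + (1 + ‖w‖) / (-w.im)
  have hκ : 0 < κ := by
    have : 0 < -w.im := by linarith
    positivity
  have hle : ∀ z : ℂ, 0 ≤ z.im → 1 + ‖z‖ ≤ κ * ‖z - w‖ := by
    intro z hz
    have h1 : 0 < -w.im := by linarith
    have h2 := hne z hz
    have h3 : ‖z‖ ≤ ‖z - w‖ + ‖w‖ := by simpa using norm_add_le (z - w) w
    have h4 : 1 + ‖w‖ ≤ (1 + ‖w‖) / (-w.im) * ‖z - w‖ := by
      calc 1 + ‖w‖ = (1 + ‖w‖) / (-w.im) * (-w.im) := (div_mul_cancel₀ _ h1.ne').symm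
        _ ≤ _ := by gcongr
    simp only [κ]
    linarith
  refine integral_eq_zero_of_upper_decay (C := C * κ ^ 3)
    (g := fun z => F z * cexp (I * σ * z) / (z - w) ^ 3) ?_ ?_
  · intro z hz
    have : z - w ≠ 0 := norm_pos_iff.1 (lt_of_lt_of_le (by linarith) (hne z hz))
    refine DifferentiableAt.differentiableWithinAt ?_
    refine DifferentiableAt.div ((hd z).mul (by fun_prop)) (by fun_prop) (pow_ne_zero _ this)
  · intro z hz
    have hpos : 0 < ‖z - w‖ := lt_of_lt_of_le (by linarith) (hne z hz)
    have h1 := hb z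
    have h2 : (I * σ * z).re = -(σ * z.im) := by simp
    rw [norm_div, norm_mul, norm_pow, Complex.norm_exp, h2]
    rw [abs_of_nonneg hz] at h1
    have h3 : ‖F z‖ * Real.exp (-(σ * z.im)) ≤ C * (1 + ‖z‖) := by
      rw [Real.exp_neg, ← div_eq_mul_inv, div_le_iff₀ (Real.exp_pos _)]
      exact h1
    rw [div_le_div_iff₀ (by positivity) (by positivity)]
    calc _ ≤ C * (1 + ‖z‖) * (1 + ‖z‖) ^ 2 := by gcongr
      _ = C * (1 + ‖z‖) ^ 3 := by ring
      _ ≤ C * (κ * ‖z - w‖) ^ 3 := by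
        have := hle z hz
        gcongr
      _ = _ := by ring

/-! ### The Fourier transform on `L¹ ∩ L²` -/

theorem continuous_fourierInv_of_integrable {g : ℝ → ℂ} (hg : Integrable g) :
    Continuous (𝓕⁻ g) :=
  VectorFourier.fourierIntegral_continuous Real.continuous_fourierChar
    (L := -innerₗ ℝ) (continuous_inner (𝕜 := ℝ) (E := ℝ)).neg hg

theorem integral_fourierInv_mul_eq {f g : ℝ → ℂ} (hf : Integrable f) (hg : Integrable g) :
    ∫ x, 𝓕⁻ f x * g x = ∫ x, f x * 𝓕⁻ g x := by
  have h := VectorFourier.integral_fourierIntegral_smul_eq_flip (L := -innerₗ ℝ)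
    Real.continuous_fourierChar (continuous_inner (𝕜 := ℝ) (E := ℝ)).neg hf hg
  have hflip : (-innerₗ ℝ).flip = -innerₗ ℝ := by
    ext
    simp
  rw [hflip] at h
  simpa using! h

/-- Both sides define the same distribution: against a test function, the `Lp` transform is moved
onto the test function by definition of the tempered transform, and the integral one by
`integral_fourierInv_mul_eq`. -/
theorem coeFn_fourierInv_toLp {g : ℝ → ℂ} (h1 : Integrable g) (h2 : MemLp g 2) :
    ((𝓕⁻ (h2.toLp g) : Lp ℂ 2 (volume : Measure ℝ)) : ℝ → ℂ) =ᵐ[volume] 𝓕⁻ g := by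
  refine ae_eq_of_integral_contDiff_smul_eq ((Lp.memLp _).locallyIntegrable (by norm_num))
    (continuous_fourierInv_of_integrable h1).locallyIntegrable fun φ hφ hφc => ?_
  have hcs : HasCompactSupport fun x => ((φ x : ℝ) : ℂ) := hφc.comp_left (g := Complex.ofReal) rfl
  have hsm : ContDiff ℝ (⊤ : ℕ∞) fun x => ((φ x : ℝ) : ℂ) := ofRealCLM.contDiff.comp hφ
  set ψ := hcs.toSchwartzMap hsm
  have hψ : ∀ x, ψ x = φ x := fun x => rfl
  have h := congrArg (fun T => T ψ) (Lp.fourierInv_toTemperedDistribution_eq (h2.toLp g))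
  simp only [TemperedDistribution.fourierInv_apply, Lp.toTemperedDistribution_apply, smul_eq_mul]
    at h
  have hl : ∫ x, (𝓕⁻ ψ) x * (h2.toLp g) x = ∫ x, φ x • 𝓕⁻ g x := by
    have : ∫ x, (𝓕⁻ ψ) x * (h2.toLp g) x = ∫ x, 𝓕⁻ (ψ : ℝ → ℂ) x * g x := by
      refine integral_congr_ae ?_
      filter_upwards [h2.coeFn_toLp] with x hx
      rw [hx, SchwartzMap.fourierInv_coe]
    rw [this, integral_fourierInv_mul_eq ψ.integrable h1]
    simp [hψ]
  rw [← hl, h]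
  simp [hψ]

theorem MeasureTheory.Integrable.memLp_two_of_bounded {g : ℝ → ℂ} (h : Integrable g) {C : ℝ}
    (hC : ∀ t, ‖g t‖ ≤ C) : MemLp g 2 := by
  rw [memLp_two_iff_integrable_sq_norm h.aestronglyMeasurable]
  refine Integrable.mono' (h.norm.const_mul C) (h.aestronglyMeasurable.norm.pow 2)
    (Eventually.of_forall fun t => ?_)
  rw [Real.norm_of_nonneg (by positivity), sq]
  gcongr
  exact hC t

theorem memLp_fourierInv {g : ℝ → ℂ} (h1 : Integrable g) (h2 : MemLp g 2) : MemLp (𝓕⁻ g) 2 :=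
  (memLp_congr_ae (coeFn_fourierInv_toLp h1 h2)).1 (Lp.memLp _)

theorem ae_eq_zero_of_fourierInv_eq_zero {g : ℝ → ℂ} (h1 : Integrable g) (h2 : MemLp g 2)
    (h : ∀ x, 𝓕⁻ g x = 0) : g =ᵐ[volume] 0 := by
  have h3 : (𝓕⁻ (h2.toLp g) : Lp ℂ 2 (volume : Measure ℝ)) = 0 := by
    rw [Lp.eq_zero_iff_ae_eq_zero]
    filter_upwards [coeFn_fourierInv_toLp h1 h2] with x hx
    rw [hx, h x, Pi.zero_apply]
  have h4 : h2.toLp g = 0 := by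
    have h5 : 𝓕 (𝓕⁻ (h2.toLp g) : Lp ℂ 2 (volume : Measure ℝ)) = h2.toLp g :=
      FourierTransform.fourier_fourierInv_eq (h2.toLp g)
    rw [h3] at h5
    rw [← h5]
    exact (Lp.fourierTransformₗᵢ ℝ ℂ).map_zero
  have h6 := h2.coeFn_toLp
  rw [h4] at h6
  exact h6.symm.trans (Lp.coeFn_zero _ _ _)

/-- `f` is the `L²` Fourier transform of `F`, in the weak sense of the Parseval identity. -/
def IsFourierPair (F f : ℝ → ℂ) : Prop :=
  MemLp f 2 ∧ ∀ g : ℝ → ℂ, Integrable g → MemLp g 2 →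
    ∫ x, F x * conj (𝓕⁻ g x) = ∫ t, f t * conj (g t)

theorem isFourierPair_toLp {F : ℝ → ℂ} (hF : MemLp F 2) :
    IsFourierPair F (𝓕 (hF.toLp F) : Lp ℂ 2 (volume : Measure ℝ)) := by
  refine ⟨Lp.memLp _, fun g h1 h2 => ?_⟩
  have h := Lp.inner_fourier_eq (𝓕⁻ (h2.toLp g)) (hF.toLp F)
  rw [FourierTransform.fourier_fourierInv_eq, L2.inner_def, L2.inner_def] at h
  have hr : ∫ x, F x * conj (𝓕⁻ g x)
      = ∫ x, inner ℂ ((𝓕⁻ (h2.toLp g) : Lp ℂ 2 (volume : Measure ℝ)) x) ((hF.toLp F) x) := by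
    refine integral_congr_ae ?_
    filter_upwards [coeFn_fourierInv_toLp h1 h2, hF.coeFn_toLp] with x hx hx'
    rw [hx, hx', RCLike.inner_apply]
  have hl : ∫ t, inner ℂ ((h2.toLp g) t) ((𝓕 (hF.toLp F) : Lp ℂ 2 (volume : Measure ℝ)) t)
      = ∫ t, (𝓕 (hF.toLp F) : Lp ℂ 2 (volume : Measure ℝ)) t * conj (g t) := by
    refine integral_congr_ae ?_
    filter_upwards [h2.coeFn_toLp] with x hx
    rw [hx, RCLike.inner_apply]
  rw [hr, ← h, hl]

theorem fourierInv_comp_neg (g : ℝ → ℂ) (x : ℝ) : 𝓕⁻ (fun t => g (-t)) x = 𝓕⁻ g (-x) := by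
  rw [Real.fourierInv_eq', Real.fourierInv_eq', ← integral_neg_eq_self]
  refine integral_congr_ae (Eventually.of_forall fun t => ?_)
  simp

/-- Reflection reduces vanishing on (-∞, -β) to vanishing on (β, ∞). -/
theorem IsFourierPair.comp_neg {F f : ℝ → ℂ} (h : IsFourierPair F f) :
    IsFourierPair (fun x => F (-x)) (fun t => f (-t)) := by
  have hmp := Measure.measurePreserving_neg (volume : Measure ℝ)
  refine ⟨h.1.comp_measurePreserving hmp, fun g h1 h2 => ?_⟩
  have := h.2 (fun t => g (-t)) h1.comp_neg (h2.comp_measurePreserving hmp)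
  rw [← integral_neg_eq_self, ← integral_neg_eq_self (fun t => f (-t) * _)]
  simpa [fourierInv_comp_neg] using this

theorem IsFourierPair.congr {F f f' : ℝ → ℂ} (h : IsFourierPair F f) (hf : f =ᵐ[volume] f') :
    IsFourierPair F f' := by
  refine ⟨(memLp_congr_ae hf).1 h.1, fun g h1 h2 => ?_⟩
  rw [h.2 g h1 h2]
  refine integral_congr_ae ?_
  filter_upwards [hf] with t ht
  rw [ht]

/-! ### The weight detecting the half line `(β, ∞)` -/

/-- The weight `(t-β)² e^{-2π(t-β)}` on `t > β`. -/
def halfLineWeight (β t : ℝ) : ℝ :=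
  (Ioi β).indicator (fun t => (t - β) ^ 2 * Real.exp (-(2 * π * (t - β)))) t

theorem halfLineWeight_nonneg (β t : ℝ) : 0 ≤ halfLineWeight β t := by
  unfold halfLineWeight
  refine indicator_nonneg (fun t _ => by positivity) t

theorem halfLineWeight_le (β t : ℝ) : halfLineWeight β t ≤ 2 := by
  unfold halfLineWeight
  refine indicator_le' (g := fun _ => (2 : ℝ)) (fun t ht => ?_) (fun _ _ => by norm_num) t
  have h0 : 0 ≤ t - β := by
    have : β < t := ht
    linarith
  rw [Real.exp_neg, ← div_eq_mul_inv, div_le_iff₀ (Real.exp_pos _)]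
  have h1 := Real.pow_div_factorial_le_exp (t - β) h0 2
  have h2 : Real.exp (t - β) ≤ Real.exp (2 * π * (t - β)) := by
    apply Real.exp_le_exp.2
    nlinarith [Real.pi_gt_three]
  have h3 : ((2 : ℕ).factorial : ℝ) = 2 := by norm_num
  rw [h3] at h1
  linarith

theorem measurable_halfLineWeight (β : ℝ) : Measurable (halfLineWeight β) :=
  Measurable.indicator (by fun_prop) measurableSet_Ioi

theorem tendsto_pow_mul_cexp_neg {r : ℂ} (hr : 0 < r.re) (n : ℕ) :
    Tendsto (fun t : ℝ => (t : ℂ) ^ n * cexp (-(r * t))) atTop (𝓝 0) := by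
  rw [tendsto_zero_iff_norm_tendsto_zero]
  refine (tendsto_rpow_mul_exp_neg_mul_atTop_nhds_zero n r.re hr).congr' ?_
  filter_upwards [eventually_ge_atTop 0] with t ht
  rw [norm_mul, norm_pow, norm_real, Real.norm_of_nonneg ht, Complex.norm_exp, Real.rpow_natCast]
  simp

theorem integrableOn_sq_mul_exp_neg {c : ℝ} (hc : 0 < c) :
    IntegrableOn (fun t : ℝ => t ^ 2 * Real.exp (-(c * t))) (Ioi 0) := by
  have := integrableOn_rpow_mul_exp_neg_mul_rpow (s := 2) (p := 1) (b := c) (by norm_num)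
    one_pos hc
  refine this.congr_fun (fun t _ => ?_) measurableSet_Ioi
  simp

theorem integral_sq_mul_exp_neg {r : ℂ} (hr : 0 < r.re) :
    ∫ t : ℝ in Ioi 0, (t : ℂ) ^ 2 * cexp (-(r * t)) = 2 / r ^ 3 := by
  have hr0 : r ≠ 0 := by rintro rfl; simp at hr
  have hderiv : ∀ t ∈ Ici (0 : ℝ), HasDerivAt
      (fun t : ℝ => -(1 / r * ((t : ℂ) ^ 2 * cexp (-(r * t)))
        + 2 / r ^ 2 * ((t : ℂ) ^ 1 * cexp (-(r * t))) + 2 / r ^ 3 * ((t : ℂ) ^ 0 * cexp (-(r * t)))))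
      ((t : ℂ) ^ 2 * cexp (-(r * t))) t := by
    intro t _
    have h1 : HasDerivAt (fun z : ℂ => cexp (-(r * z))) (cexp (-(r * t)) * -(r * 1)) (t : ℂ) :=
      (((hasDerivAt_id _).const_mul r).neg).cexp
    have h2 := ((((hasDerivAt_pow 2 (t : ℂ)).mul h1).const_mul (1 / r)).add
      (((hasDerivAt_pow 1 (t : ℂ)).mul h1).const_mul (2 / r ^ 2))).add
      (((hasDerivAt_pow 0 (t : ℂ)).mul h1).const_mul (2 / r ^ 3))
    convert! h2.neg.comp_ofReal using 1
    push_cast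
    field_simp
    ring
  have hint : IntegrableOn (fun t : ℝ => (t : ℂ) ^ 2 * cexp (-(r * t))) (Ioi 0) := by
    refine (integrableOn_sq_mul_exp_neg hr).mono'
      (Continuous.aestronglyMeasurable (by fun_prop)) (Eventually.of_forall fun t => le_of_eq ?_)
    rw [norm_mul, norm_pow, norm_real, Real.norm_eq_abs, sq_abs, Complex.norm_exp]
    simp
  have hlim := (((tendsto_pow_mul_cexp_neg hr 2).const_mul (1 / r)).add
    ((tendsto_pow_mul_cexp_neg hr 1).const_mul (2 / r ^ 2))).add
    ((tendsto_pow_mul_cexp_neg hr 0).const_mul (2 / r ^ 3))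
  rw [integral_Ioi_of_hasDerivAt_of_tendsto' hderiv hint hlim.neg]
  simp

theorem integrable_halfLineWeight (β : ℝ) : Integrable (halfLineWeight β) := by
  have h := integrableOn_sq_mul_exp_neg (c := 2 * π) (by positivity)
  unfold halfLineWeight
  rw [integrable_indicator_iff measurableSet_Ioi]
  have h2 := (integrable_indicator_iff measurableSet_Ioi).2 h
  rw [← integrable_indicator_iff measurableSet_Ioi]
  refine (h2.comp_sub_right β).congr (Eventually.of_forall fun t => ?_)
  simp [indicator_apply]

/-- After the shift by β this is a Laplace integral. The quadratic factor of the weight produces the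
cubic pole needed against the linear growth of F. -/
theorem integral_halfLineWeight_mul_exp (β y : ℝ) :
    ∫ t, (halfLineWeight β t : ℂ) * cexp (2 * π * I * t * y)
      = cexp (2 * π * I * β * y) * (2 / (2 * π * (1 - I * y)) ^ 3) := by
  have hre : 0 < (2 * π * (1 - I * y) : ℂ).re := by
    simp [Real.pi_pos]
  rw [← integral_sq_mul_exp_neg hre, ← integral_add_right_eq_self _ β, ← integral_const_mul,
    ← integral_indicator measurableSet_Ioi]
  refine integral_congr_ae (Eventually.of_forall fun t => ?_)
  simp only [halfLineWeight, indicator_apply, mem_Ioi, lt_add_iff_pos_left, add_sub_cancel_right]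
  split_ifs with ht
  · push_cast
    rw [mul_assoc, mul_left_comm (cexp _), ← Complex.exp_add, ← Complex.exp_add]
    congr 2
    ring
  · simp

/-! ### The Paley-Wiener theorem -/

/-- The product of f with the half-line weight has zero inverse transform: by Parseval its value at
ξ is a multiple of ∫ F(-x) e^{2πiβx} / (x + ξ + i)³ dx, which Cauchy's theorem in the upper half
plane kills. The weight is nonzero on (β, ∞), so f vanishes there. -/
theorem IsFourierPair.ae_eq_zero_Ioi {β C : ℝ} {F : ℂ → ℂ} {f : ℝ → ℂ}
    (hd : Differentiable ℂ F)
    (hb : ∀ z, ‖F z‖ ≤ C * (1 + ‖z‖) * Real.exp (2 * π * β * |z.im|))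
    (hp : IsFourierPair (fun x : ℝ => F x) f) : ∀ᵐ t : ℝ, β < t → f t = 0 := by
  have hm := integrable_halfLineWeight β
  have hmeas := measurable_halfLineWeight β
  have hmn : ∀ t, ‖(halfLineWeight β t : ℂ)‖ ≤ 2 := fun t => by
    rw [norm_real, Real.norm_of_nonneg (halfLineWeight_nonneg β t)]
    exact halfLineWeight_le β t
  have hm2 : MemLp (fun t => (halfLineWeight β t : ℂ)) 2 := hm.ofReal.memLp_two_of_bounded hmn
  set p : ℝ → ℂ := fun t => f t * halfLineWeight β t
  have hp1 : Integrable p := hp.1.integrable_mul hm2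
  have hp2 : MemLp p 2 := by
    refine hp.1.of_le_mul (c := 2) hp1.aestronglyMeasurable (Eventually.of_forall fun t => ?_)
    simp only [p, norm_mul]
    nlinarith [hmn t, norm_nonneg (f t)]
  have hzero : ∀ x, 𝓕⁻ p x = 0 := by
    intro ξ
    -- Modulated by -ξ, so that conj g carries the factor e^{2πiξt} of the inverse transform at ξ.
    set g : ℝ → ℂ := fun t => halfLineWeight β t * cexp (2 * π * I * t * (-ξ : ℝ))
    have hphase : ∀ t : ℝ, ‖cexp (2 * π * I * t * (-ξ : ℝ))‖ = 1 := fun t => by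
      rw [Complex.norm_exp]; simp
    have hg1 : Integrable g := by
      refine (hm.ofReal (𝕜 := ℂ)).mono
        (Measurable.aestronglyMeasurable (by fun_prop)) (Eventually.of_forall fun t => ?_)
      simp only [g]
      rw [norm_mul, hphase, mul_one]
      rfl
    have hg2 : MemLp g 2 := hg1.memLp_two_of_bounded (C := 2) fun t => by
      simp only [g]
      rw [norm_mul, hphase, mul_one]
      exact hmn t
    have hpair := hp.2 g hg1 hg2
    have h1 : 𝓕⁻ p ξ = ∫ t, f t * conj (g t) := by
      rw [Real.fourierInv_eq']
      refine integral_congr_ae (Eventually.of_forall fun t => ?_)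
      simp only [p, g, smul_eq_mul, map_mul, conj_ofReal, ← exp_conj, conj_I, map_ofNat]
      rw [mul_comm (cexp _), mul_assoc]
      congr 3
      simp
      ring
    rw [h1, ← hpair, ← integral_neg_eq_self]
    have h2 := integral_mul_exp_div_cube_eq_zero (σ := 2 * π * β) (C := C)
      (F := fun z => F (-z)) (hd.comp differentiable_neg) (fun z => by simpa using hb (-z))
      (w := -ξ - I) (by simp)
    have h3 : ∀ x : ℝ, F ((-x : ℝ) : ℂ) * conj (𝓕⁻ g (-x))
        = (2 * (cexp (2 * π * I * β * ξ) / ((2 * π) ^ 3 * I))) *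
          (F (-x) * cexp (I * (2 * π * β : ℝ) * x) / (x - (-ξ - I)) ^ 3) := by
      intro x
      have h4 : 𝓕⁻ g (-x) = ∫ t, (halfLineWeight β t : ℂ) * cexp (2 * π * I * t * (-x - ξ : ℝ)) := by
        rw [Real.fourierInv_eq']
        refine integral_congr_ae (Eventually.of_forall fun t => ?_)
        simp only [g, smul_eq_mul]
        rw [mul_left_comm, ← Complex.exp_add]
        congr 2
        simp
        ring
      rw [h4, integral_halfLineWeight_mul_exp]
      have h5 : conj (cexp (2 * π * I * β * (-x - ξ : ℝ)) * (2 / (2 * π * (1 - I * (-x - ξ : ℝ))) ^ 3))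
          = cexp (2 * π * I * β * ξ) * cexp (I * (2 * π * β : ℝ) * x)
            * (2 / (2 * π * (1 - I * (x + ξ))) ^ 3) := by
        simp only [map_mul, map_div₀, map_pow, map_sub, map_one, ← exp_conj, conj_I, conj_ofReal,
          map_ofNat]
        rw [← Complex.exp_add]
        push_cast
        congr 2
        · ring
        · ring
      have h6 : (1 - I * (x + ξ) : ℂ) = -I * (x - (-ξ - I)) := by
        linear_combination I_mul_I
      have h7 : (-I) ^ 3 = I := by
        rw [neg_pow, I_pow_three]; norm_num
      have h8 : (x - (-ξ - I) : ℂ) ≠ 0 := by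
        intro h0
        have := congrArg Complex.im h0
        simp at this
      have hpi : (π : ℂ) ≠ 0 := by exact_mod_cast Real.pi_ne_zero
      rw [h5, h6, mul_pow, mul_pow (-I), h7, ofReal_neg]
      field_simp
    simp_rw [h3]
    rw [integral_const_mul, h2, mul_zero]
  filter_upwards [ae_eq_zero_of_fourierInv_eq_zero hp1 hp2 hzero] with t ht hβ
  have hw : halfLineWeight β t ≠ 0 := by
    rw [halfLineWeight, indicator_of_mem (by exact hβ)]
    have : t - β ≠ 0 := by linarith
    positivity
  have h0 : f t * halfLineWeight β t = 0 := ht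
  rcases mul_eq_zero.1 h0 with h | h
  · exact h
  · exact absurd (by exact_mod_cast h) hw

/-- The Fourier-Laplace transform `z ↦ ∫ k(t) e^{2πitz} dt`. -/
def expTransform (k : ℝ → ℂ) (z : ℂ) : ℂ :=
  ∫ t : ℝ, k t * cexp (2 * π * I * t * z)

theorem fourierInv_eq_expTransform (k : ℝ → ℂ) (x : ℝ) : 𝓕⁻ k x = expTransform k x := by
  rw [Real.fourierInv_eq', expTransform]
  refine integral_congr_ae (Eventually.of_forall fun t => ?_)
  simp only [smul_eq_mul]
  rw [mul_comm]
  congr 2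
  simp
  ring

theorem norm_exp_two_pi_le {β : ℝ} {t : ℝ} (ht : t ∈ Icc (-β) β) (z : ℂ) :
    ‖cexp (2 * π * I * t * z)‖ ≤ Real.exp (2 * π * β * ‖z‖) := by
  rw [Complex.norm_exp]
  apply Real.exp_le_exp.2
  have h1 : (2 * π * I * t * z).re = 2 * π * (-(t * z.im)) := by simp; ring
  have h2 : -(t * z.im) ≤ β * ‖z‖ := by
    calc -(t * z.im) ≤ |t * z.im| := neg_le_abs _
      _ = |t| * |z.im| := abs_mul _ _
      _ ≤ β * ‖z‖ := by
        have := abs_im_le_norm z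
        have h3 := abs_le.2 ht
        have h4 : 0 ≤ β := (abs_nonneg t).trans h3
        gcongr
  rw [h1, mul_assoc (2 * π)]
  exact mul_le_mul_of_nonneg_left h2 (by positivity)

/-! ### Transforms of functions supported in [-β, β]. -/

section

variable {β : ℝ} {k : ℝ → ℂ}

theorem integrable_mul_exp (hk : Integrable k) (hs : ∀ t, t ∉ Icc (-β) β → k t = 0) (z : ℂ) :
    Integrable fun t : ℝ => k t * cexp (2 * π * I * t * z) := by
  refine (hk.norm.mul_const (Real.exp (2 * π * β * ‖z‖))).mono'
    (hk.aestronglyMeasurable.mul (Continuous.aestronglyMeasurable (by fun_prop)))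
    (Eventually.of_forall fun t => ?_)
  by_cases ht : t ∈ Icc (-β) β
  · rw [norm_mul]
    gcongr
    exact norm_exp_two_pi_le ht z
  · simp [hs t ht]

theorem norm_expTransform_le (hk : Integrable k) (hs : ∀ t, t ∉ Icc (-β) β → k t = 0) (z : ℂ) :
    ‖expTransform k z‖ ≤ (∫ t, ‖k t‖) * Real.exp (2 * π * β * ‖z‖) := by
  rw [← integral_mul_const]
  refine norm_integral_le_of_norm_le (hk.norm.mul_const _) (Eventually.of_forall fun t => ?_)
  by_cases ht : t ∈ Icc (-β) β
  · rw [norm_mul]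
    gcongr
    exact norm_exp_two_pi_le ht z
  · simp [hs t ht]

theorem differentiable_expTransform (hk : Integrable k)
    (hs : ∀ t, t ∉ Icc (-β) β → k t = 0) : Differentiable ℂ (expTransform k) := by
  intro z₀
  refine (hasDerivAt_integral_of_dominated_loc_of_deriv_le
    (F := fun (z : ℂ) (t : ℝ) => k t * cexp (2 * π * I * t * z))
    (F' := fun (z : ℂ) (t : ℝ) => k t * (cexp (2 * π * I * t * z) * (2 * π * I * t)))
    (bound := fun t => ‖k t‖ * (Real.exp (2 * π * |β| * (‖z₀‖ + 1)) * (2 * π * |β|)))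
    (s := Metric.ball z₀ 1) (Metric.ball_mem_nhds z₀ one_pos)
    (Eventually.of_forall fun z => (integrable_mul_exp hk hs z).aestronglyMeasurable)
    (integrable_mul_exp hk hs z₀)
    (hk.aestronglyMeasurable.mul (Continuous.aestronglyMeasurable (by fun_prop)))
    (Eventually.of_forall fun t z hz => ?_) (hk.norm.mul_const _)
    (Eventually.of_forall fun t z _ => ?_)).2.differentiableAt
  · by_cases ht : t ∈ Icc (-β) β
    · rw [norm_mul, norm_mul]
      have h1 : |t| ≤ |β| := (abs_le.2 ht).trans (le_abs_self _)
      have h2 : ‖z‖ ≤ ‖z₀‖ + 1 := by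
        have h3 : ‖z - z₀‖ < 1 := by simpa [dist_eq_norm] using hz
        have h4 := norm_add_le (z - z₀) z₀
        rw [sub_add_cancel] at h4
        linarith
      have h5 : ‖(2 * π * I * t : ℂ)‖ ≤ 2 * π * |β| := by
        simp only [norm_mul, norm_I, norm_real, RCLike.norm_ofNat, Real.norm_eq_abs, mul_one,
          abs_of_pos Real.pi_pos]
        gcongr
      have h6 : ‖cexp (2 * π * I * t * z)‖ ≤ Real.exp (2 * π * |β| * (‖z₀‖ + 1)) := by
        refine (norm_exp_two_pi_le (β := |β|) (abs_le.1 h1) z).trans ?_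
        gcongr
      gcongr
    · simp [hs t ht]
  · have h := ((hasDerivAt_id z).const_mul (2 * π * I * t : ℂ)).cexp
    simpa using h.const_mul (k t)

end

theorem eq_of_eq_ofReal {F G : ℂ → ℂ} (hF : Differentiable ℂ F) (hG : Differentiable ℂ G)
    (h : ∀ x : ℝ, F x = G x) : F = G := by
  refine AnalyticOnNhd.eq_of_frequently_eq (z₀ := 0) (𝕜 := ℂ)
    (fun z _ => hF.analyticAt z) (fun z _ => hG.analyticAt z) ?_
  have h1 : ∃ᶠ x : ℝ in 𝓝[≠] 0, F x = G x := Eventually.frequently (Eventually.of_forall h)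
  have h2 : Tendsto (fun x : ℝ => (x : ℂ)) (𝓝[≠] 0) (𝓝[≠] 0) := by
    refine tendsto_nhdsWithin_of_tendsto_nhds_of_eventually_within _ ?_ ?_
    · exact (continuous_ofReal.tendsto' 0 0 (by simp)).mono_left nhdsWithin_le_nhds
    · filter_upwards [self_mem_nhdsWithin] with x hx
      simpa using hx
  exact h2.frequently h1

namespace SpKernel

theorem expTransform_mem_space {Δ C : ℝ} {k : ℝ → ℂ} (hk : Integrable k) (hb : ∀ t, ‖k t‖ ≤ C)
    (hs : ∀ t, t ∉ Icc (-(Δ / 2)) (Δ / 2) → k t = 0) : expTransform k ∈ space Δ := by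
  refine ⟨differentiable_expTransform hk hs,
    exponentialType_le_of_norm_le (C := ∫ t, ‖k t‖) fun z => ?_,
    integrable_density_of_memLp_two ?_⟩
  · have := norm_expTransform_le hk hs z
    rwa [show 2 * π * (Δ / 2) = π * Δ by ring] at this
  · simp_rw [← fourierInv_eq_expTransform]
    exact memLp_fourierInv hk (hk.memLp_two_of_bounded hb)

/-- The Paley-Wiener theorem for the space `space Δ`. -/
theorem exists_expTransform_eq {Δ : ℝ} (hΔ : 0 < Δ) {F : ℂ → ℂ} (hF : F ∈ space Δ) :
    ∃ f : ℝ → ℂ, Integrable f ∧ (∀ t, t ∉ Icc (-(Δ / 2)) (Δ / 2) → f t = 0) ∧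
      IsFourierPair (fun x : ℝ => F x) f ∧ F = expTransform f := by
  obtain ⟨hd, htype, hint⟩ := hF
  have hL := memLp_two_of_integrable_density hd.continuous hint
  obtain ⟨C, -, hb⟩ := exists_norm_le_of_memLp (by positivity) hd
    (hasExpGrowth_of_exponentialType_le hd.continuous htype) hL
  rw [show π * Δ = 2 * π * (Δ / 2) by ring] at hb
  have hp := isFourierPair_toLp hL
  set f₀ : ℝ → ℂ := ⇑(𝓕 (hL.toLp _) : Lp ℂ 2 (volume : Measure ℝ))
  have hpos := hp.ae_eq_zero_Ioi hd hb
  have hneg : ∀ᵐ t : ℝ, Δ / 2 < -t → f₀ t = 0 := by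
    have hp' : IsFourierPair (fun x : ℝ => (fun z => F (-z)) x) (fun t => f₀ (-t)) := by
      simpa using hp.comp_neg
    have h1 := hp'.ae_eq_zero_Ioi (F := fun z => F (-z)) (hd.comp differentiable_neg)
      (fun z => by simpa using hb (-z))
    have h2 := (Measure.measurePreserving_neg (volume : Measure ℝ)).quasiMeasurePreserving.ae h1
    filter_upwards [h2] with t ht hlt
    simpa using ht hlt
  -- The cut-off changes f₀ on a null set only. It makes the support condition pointwise, and L² on
  -- a compact interval gives integrability.
  set f : ℝ → ℂ := (Icc (-(Δ / 2)) (Δ / 2)).indicator f₀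
  have hff : f₀ =ᵐ[volume] f := by
    filter_upwards [hpos, hneg] with t h1 h2
    by_cases ht : t ∈ Icc (-(Δ / 2)) (Δ / 2)
    · simp [f, indicator_of_mem ht]
    · simp only [f, indicator_of_notMem ht]
      rw [mem_Icc, not_and_or, not_le, not_le] at ht
      rcases ht with h | h
      · exact h2 (by linarith)
      · exact h1 h
  have hs : ∀ t, t ∉ Icc (-(Δ / 2)) (Δ / 2) → f t = 0 := fun t ht => indicator_of_notMem ht _
  have hpf := hp.congr hff
  have hf2 := hpf.1
  have hf1 : Integrable f := by
    refine (integrable_indicator_iff measurableSet_Icc).2 ?_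
    exact ((Lp.memLp (𝓕 (hL.toLp _) : Lp ℂ 2 (volume : Measure ℝ))).locallyIntegrable
      (by norm_num)).integrableOn_isCompact isCompact_Icc
  refine ⟨f, hf1, hs, hpf, ?_⟩
  have hto : hf2.toLp f = (𝓕 (hL.toLp _) : Lp ℂ 2 (volume : Measure ℝ)) := by
    refine Lp.ext (hf2.coeFn_toLp.trans hff.symm)
  have hinv := coeFn_fourierInv_toLp hf1 hf2
  have hcancel : 𝓕⁻ (𝓕 (hL.toLp _) : Lp ℂ 2 (volume : Measure ℝ)) = hL.toLp _ :=
    FourierTransform.fourierInv_fourier_eq _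
  rw [hto, hcancel] at hinv
  have hae := hL.coeFn_toLp.symm.trans hinv
  have heq := Continuous.ae_eq_iff_eq (μ := (volume : Measure ℝ))
    (hd.continuous.comp continuous_ofReal) (continuous_fourierInv_of_integrable hf1) |>.1 hae
  refine eq_of_eq_ofReal hd (differentiable_expTransform hf1 hs) fun x => ?_
  rw [← fourierInv_eq_expTransform]
  exact congrFun heq x

/-! ### The integral equation on the Fourier side -/

theorem fourierInv_mul_convolution_eq {f g : ℝ → ℂ} (hf : Integrable f) (hg : Integrable g)
    (x : ℝ) : 𝓕⁻ (f ⋆[ContinuousLinearMap.mul ℂ ℂ] g) x = 𝓕⁻ f x * 𝓕⁻ g x := by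
  simp only [Real.fourierInv_eq_fourier_neg]
  exact Real.fourier_mul_convolution_eq hf hg (-x)

/-- This turns multiplication by `density` into the identity minus half a convolution with the
indicator. -/
theorem fourierInv_indicator_Ioc (x : ℝ) :
    𝓕⁻ ((Ioc (-1 : ℝ) 1).indicator fun _ => (1 : ℂ)) x = 2 * (Real.sinc (2 * π * x) : ℂ) := by
  rw [Real.fourierInv_eq']
  have h1 : ∀ t : ℝ, cexp (↑(2 * π * inner ℝ t x) * I) • (Ioc (-1 : ℝ) 1).indicator
      (fun _ => (1 : ℂ)) t = (Ioc (-1 : ℝ) 1).indicator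
      (fun t : ℝ => cexp (((2 * π * x) * t : ℝ) * I)) t := by
    intro t
    by_cases ht : t ∈ Ioc (-1 : ℝ) 1
    · simp only [indicator_of_mem ht, smul_eq_mul, mul_one]
      congr 3
      simp
      ring
    · simp [indicator_of_notMem ht]
  simp_rw [h1]
  rw [integral_indicator measurableSet_Ioc, ← intervalIntegral.integral_of_le (by norm_num)]
  rcases eq_or_ne x 0 with rfl | hx
  · norm_num
  · have hc : 2 * π * x ≠ 0 := by positivity
    rw [intervalIntegral.integral_comp_mul_left (fun t : ℝ => cexp ((t : ℂ) * I)) hc]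
    have h2 := integral_exp_mul_I_eq_sinc (2 * π * x)
    rw [mul_neg, mul_one, h2, real_smul]
    have : (x : ℂ) ≠ 0 := by exact_mod_cast hx
    push_cast
    field_simp

theorem convolution_indicator_Ioc (k : ℝ → ℂ) (t : ℝ) :
    (((Ioc (-1 : ℝ) 1).indicator fun _ => (1 : ℂ)) ⋆[ContinuousLinearMap.mul ℂ ℂ] k) t
      = ∫ s in (t - 1)..(t + 1), k s := by
  rw [convolution_def]
  have h1 : ∀ s : ℝ, ContinuousLinearMap.mul ℂ ℂ ((Ioc (-1 : ℝ) 1).indicator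
      (fun _ => (1 : ℂ)) s) (k (t - s)) = (Ioc (-1 : ℝ) 1).indicator (fun s => k (t - s)) s := by
    intro s
    by_cases hs : s ∈ Ioc (-1 : ℝ) 1
    · simp [indicator_of_mem hs]
    · simp [indicator_of_notMem hs]
  simp_rw [h1]
  rw [integral_indicator measurableSet_Ioc, ← intervalIntegral.integral_of_le (by norm_num),
    intervalIntegral.integral_comp_sub_left]
  congr 1
  ring

/-- A bounded solution of the integral equation on the Fourier side yields an element of the space
that reproduces the value at `conj v`. -/
theorem mem_space_and_reproduces_of_solution {Δ C : ℝ} (hΔ : 0 < Δ) {k : ℝ → ℂ} {v : ℂ}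
    (hk : Integrable k) (hb : ∀ t, ‖k t‖ ≤ C)
    (hs : ∀ t, t ∉ Icc (-(Δ / 2)) (Δ / 2) → k t = 0)
    (heq : ∀ t ∈ Ioo (-(Δ / 2)) (Δ / 2),
      k t - 1 / 2 * ∫ s in (t - 1)..(t + 1), k s = cexp (-(2 * π * I * t * v))) :
    expTransform k ∈ space Δ ∧ ∀ F ∈ space Δ, F (conj v) = innerProd F (expTransform k) := by
  refine ⟨expTransform_mem_space hk hb hs, fun F hF => ?_⟩
  obtain ⟨f, hf1, hfs, hp, hFf⟩ := exists_expTransform_eq hΔ hF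
  set J : ℝ → ℂ := (Ioc (-1 : ℝ) 1).indicator fun _ => (1 : ℂ)
  have hJ : Integrable J := (integrable_indicator_iff measurableSet_Ioc).2 (by simp)
  have hconv : Integrable (J ⋆[ContinuousLinearMap.mul ℂ ℂ] k) := hJ.integrable_convolution _ hk
  -- The inverse transform of g is `expTransform k` times the real weight, so the weighted inner
  -- product is an unweighted Parseval pairing of f with g. Outside the support of f the values of g
  -- do not matter.
  set g : ℝ → ℂ := fun t => k t - 1 / 2 * (J ⋆[ContinuousLinearMap.mul ℂ ℂ] k) t
  have hg1 : Integrable g := hk.sub (hconv.const_mul _)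
  have hgb : ∀ t, ‖g t‖ ≤ C + 1 / 2 * (∫ s, ‖k s‖) := by
    intro t
    refine (norm_sub_le _ _).trans (add_le_add (hb t) ?_)
    rw [norm_mul, convolution_indicator_Ioc, norm_div, norm_one, RCLike.norm_ofNat]
    gcongr
    refine (intervalIntegral.norm_integral_le_integral_norm (by linarith)).trans ?_
    rw [intervalIntegral.integral_of_le (by linarith)]
    exact setIntegral_le_integral hk.norm (Eventually.of_forall fun s => norm_nonneg _)
  have hgF : ∀ x : ℝ, 𝓕⁻ g x = expTransform k x * density x := by
    intro x
    have h1 : 𝓕⁻ g x = 𝓕⁻ k x - 1 / 2 * 𝓕⁻ (J ⋆[ContinuousLinearMap.mul ℂ ℂ] k) x := by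
      have hint : ∀ {p : ℝ → ℂ}, Integrable p →
          Integrable fun t : ℝ => cexp (↑(2 * π * inner ℝ t x) * I) • p t := by
        intro p hp
        have hc : Continuous fun t : ℝ => cexp (↑(2 * π * inner ℝ t x) * I) := by fun_prop
        refine hp.norm.mono' (hc.aestronglyMeasurable.smul
          hp.aestronglyMeasurable) (Eventually.of_forall fun t => ?_)
        rw [norm_smul, Complex.norm_exp_ofReal_mul_I, one_mul]
      rw [Real.fourierInv_eq', Real.fourierInv_eq', Real.fourierInv_eq', ← integral_const_mul,
        ← integral_sub (hint hk) ((hint hconv).const_mul _)]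
      refine integral_congr_ae (Eventually.of_forall fun t => ?_)
      simp only [g, smul_eq_mul]
      ring
    rw [h1, fourierInv_mul_convolution_eq hJ hk, fourierInv_indicator_Ioc,
      fourierInv_eq_expTransform, density]
    push_cast
    ring
  have hpair := hp.2 g hg1 (hg1.memLp_two_of_bounded hgb)
  have hleft : innerProd F (expTransform k) = ∫ t, f t * conj (g t) := by
    rw [← hpair, innerProd]
    refine integral_congr_ae (Eventually.of_forall fun x => ?_)
    simp only [hgF, map_mul, conj_ofReal]
    ring
  rw [hleft, hFf, expTransform]
  refine integral_congr_ae ?_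
  -- The integral equation is assumed on the open interval only; its end points form a null set.
  have hae : ∀ᵐ t : ℝ, t ≠ -(Δ / 2) ∧ t ≠ Δ / 2 :=
    ((countable_singleton _).ae_notMem _).and ((countable_singleton _).ae_notMem _)
  filter_upwards [hae] with t ht
  by_cases hmem : t ∈ Ioo (-(Δ / 2)) (Δ / 2)
  · have h1 : g t = cexp (-(2 * π * I * t * v)) := by
      simp only [g]
      rw [convolution_indicator_Ioc, heq t hmem]
    rw [h1, ← exp_conj]
    congr 2
    simp only [map_neg, map_mul, conj_ofReal, conj_I, map_ofNat]
    ring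
  · have : t ∉ Icc (-(Δ / 2)) (Δ / 2) := fun h =>
      hmem ⟨lt_of_le_of_ne h.1 (Ne.symm ht.1), lt_of_le_of_ne h.2 ht.2⟩
    rw [hfs t this, zero_mul, zero_mul]

end SpKernel

namespace SpKernel

/-! ### Exponential integrals -/

theorem integral_exp_mul (a b : ℝ) (s : ℂ) :
    ∫ t in a..b, cexp (2 * t * s) = expQuot (2 * b) (2 * a) s / 2 := by
  unfold expQuot
  split_ifs with hs
  · subst hs
    simp
    ring
  · have h := integral_exp_mul_complex (a := a) (b := b) (c := 2 * s) (by simpa using hs)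
    have h2 : ∀ t : ℝ, cexp (2 * t * s) = cexp (2 * s * t) := fun t => by congr 1; ring
    simp_rw [h2]
    rw [h]
    have e1 : 2 * s * b = ((2 * b : ℝ) : ℂ) * s := by push_cast; ring
    have e2 : 2 * s * a = ((2 * a : ℝ) : ℂ) * s := by push_cast; ring
    rw [e1, e2]
    field_simp

theorem sincFun_mul (c : ℝ) (z : ℂ) :
    sincFun c z * (2 * π * I * z) = cexp (π * I * c * z) - cexp (-(π * I * c * z)) := by
  unfold sincFun
  split_ifs with hz
  · simp [hz]
  · have hpi : (π : ℂ) ≠ 0 := by exact_mod_cast Real.pi_ne_zero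
    have h1 : π * c * z * I = π * I * c * z := by ring
    have h2 : -(π * c * z) * I = -(π * I * c * z) := by ring
    rw [Complex.sin, h1, h2]
    field_simp
    linear_combination (cexp (-(π * I * c * z)) - cexp (π * I * c * z)) * I_sq

theorem integral_exp_eq_sincFun (γ : ℝ) (z : ℂ) :
    ∫ t in (-γ)..γ, cexp (2 * π * I * t * z) = sincFun (2 * γ) z := by
  have h : ∀ t : ℝ, cexp (2 * π * I * t * z) = cexp (2 * t * (π * I * z)) := fun t => by
    congr 1; ring
  simp_rw [h]
  rw [integral_exp_mul]
  rcases eq_or_ne z 0 with rfl | hz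
  · simp [expQuot, sincFun]
  · have hpi : (π : ℂ) ≠ 0 := by exact_mod_cast Real.pi_ne_zero
    have hne : π * I * z ≠ 0 := by simp [hpi, hz]
    have h1 := sincFun_mul (2 * γ) z
    rw [expQuot, if_neg hne]
    have e1 : ((2 * γ : ℝ) : ℂ) * (π * I * z) = π * I * (2 * γ : ℝ) * z := by push_cast; ring
    have e2 : ((2 * -γ : ℝ) : ℂ) * (π * I * z) = -(π * I * (2 * γ : ℝ) * z) := by push_cast; ring
    rw [e1, e2, ← h1]
    field_simp

theorem sincFun_neg (c : ℝ) (z : ℂ) : sincFun c (-z) = sincFun c z := by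
  simp only [sincFun, neg_eq_zero, mul_neg, Complex.sin_neg, neg_div_neg_eq]

theorem expQuot_neg_swap (α β : ℝ) (s : ℂ) : expQuot α β s = -expQuot β α s := by
  unfold expQuot
  split_ifs
  · ring
  · ring

/-! ### Gluing functions on adjacent intervals -/

/-- The function equal to `kL` on `[-β, -γ)`, to `kM` on `[-γ, γ]` and to `kR` on `(γ, β]`. -/
def glue (γ β : ℝ) (kL kM kR : ℝ → ℂ) (t : ℝ) : ℂ :=
  (Icc (-β) β).indicator (fun t => if t < -γ then kL t else if t ≤ γ then kM t else kR t) t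

section glue

variable {γ β : ℝ} {kL kM kR : ℝ → ℂ}

theorem glue_of_notMem {t : ℝ} (ht : t ∉ Icc (-β) β) : glue γ β kL kM kR t = 0 :=
  indicator_of_notMem ht _

theorem glue_bounded (hL : Continuous kL) (hM : Continuous kM) (hR : Continuous kR) :
    ∃ C, 0 ≤ C ∧ ∀ t, ‖glue γ β kL kM kR t‖ ≤ C := by
  obtain ⟨a, ha⟩ := isCompact_Icc.exists_bound_of_continuousOn (s := Icc (-β) β) hL.continuousOn
  obtain ⟨b, hb⟩ := isCompact_Icc.exists_bound_of_continuousOn (s := Icc (-β) β) hM.continuousOn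
  obtain ⟨c, hc⟩ := isCompact_Icc.exists_bound_of_continuousOn (s := Icc (-β) β) hR.continuousOn
  refine ⟨|a| + |b| + |c|, by positivity, fun t => ?_⟩
  have h1 := abs_nonneg a
  have h2 := abs_nonneg b
  have h3 := abs_nonneg c
  by_cases ht : t ∈ Icc (-β) β
  · rw [glue, indicator_of_mem ht]
    split_ifs
    · linarith [ha t ht, le_abs_self a]
    · linarith [hb t ht, le_abs_self b]
    · linarith [hc t ht, le_abs_self c]
  · rw [glue_of_notMem ht, norm_zero]
    positivity

theorem integrable_glue (hL : Continuous kL) (hM : Continuous kM) (hR : Continuous kR) :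
    Integrable (glue γ β kL kM kR) := by
  obtain ⟨C, -, hC⟩ := glue_bounded (γ := γ) (β := β) hL hM hR
  have hmeas : Measurable (glue γ β kL kM kR) := by
    refine Measurable.indicator ?_ measurableSet_Icc
    exact Measurable.ite measurableSet_Iio hL.measurable
      (Measurable.ite measurableSet_Iic hM.measurable hR.measurable)
  refine Integrable.mono' (g := (Icc (-β) β).indicator fun _ => C) ?_
    hmeas.aestronglyMeasurable (Eventually.of_forall fun t => ?_)
  · exact (integrable_indicator_iff measurableSet_Icc).2 (by simp)
  · by_cases ht : t ∈ Icc (-β) β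
    · rw [indicator_of_mem ht]
      exact hC t
    · rw [glue_of_notMem ht, indicator_of_notMem ht, norm_zero]

theorem integral_glue_eq_zero_of_le {a : ℝ} (ha : a ≤ -β) :
    ∫ t in a..(-β), glue γ β kL kM kR t = 0 := by
  rw [intervalIntegral.integral_of_le ha, integral_Ioc_eq_integral_Ioo]
  refine setIntegral_eq_zero_of_forall_eq_zero fun t ht => glue_of_notMem fun h => ?_
  exact absurd h.1 (not_le.2 ht.2)

theorem integral_glue_eq_zero_of_ge {b : ℝ} (hb : β ≤ b) :
    ∫ t in β..b, glue γ β kL kM kR t = 0 := by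
  rw [intervalIntegral.integral_of_le hb]
  refine setIntegral_eq_zero_of_forall_eq_zero fun t ht => glue_of_notMem fun h => ?_
  exact absurd h.2 (not_le.2 ht.1)

/-- Both break points belong to the middle piece; matching values there let each outer formula hold
on a closed interval. -/
theorem glue_left (hγ : 0 ≤ γ) (hγβ : γ ≤ β) (h : kL (-γ) = kM (-γ)) {t : ℝ}
    (ht : t ∈ Icc (-β) (-γ)) : glue γ β kL kM kR t = kL t := by
  have hmem : t ∈ Icc (-β) β := ⟨ht.1, by linarith [ht.2]⟩
  rw [glue, indicator_of_mem hmem]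
  rcases ht.2.lt_or_eq with hlt | rfl
  · rw [if_pos hlt]
  · rw [if_neg (lt_irrefl _), if_pos (by linarith), h]

theorem glue_middle (hγβ : γ ≤ β) {t : ℝ}
    (ht : t ∈ Icc (-γ) γ) : glue γ β kL kM kR t = kM t := by
  have hmem : t ∈ Icc (-β) β := ⟨by linarith [ht.1], by linarith [ht.2]⟩
  rw [glue, indicator_of_mem hmem, if_neg (not_lt.2 ht.1),
    if_pos ht.2]

theorem glue_right (hγ : 0 ≤ γ) (h : kR γ = kM γ) {t : ℝ}
    (ht : t ∈ Icc γ β) : glue γ β kL kM kR t = kR t := by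
  have hmem : t ∈ Icc (-β) β := ⟨by linarith [ht.1, ht.2], ht.2⟩
  rw [glue, indicator_of_mem hmem, if_neg (by linarith [ht.1])]
  rcases ht.1.lt_or_eq with hlt | rfl
  · rw [if_neg (not_le.2 hlt)]
  · rw [if_pos le_rfl, h]

end glue

/-! ### The case `Δ ≤ 1` -/

/-- The kernel for `Δ ≤ 1`. -/
def smallKernel (Δ : ℝ) (w z : ℂ) : ℂ :=
  sincFun Δ (z - conj w) + 1 / (2 - (Δ : ℂ)) * sincFun Δ z * sincFun Δ (conj w)

theorem exp_mul_exp_sub (t : ℝ) (v z : ℂ) :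
    cexp (-(2 * π * I * t * v)) * cexp (2 * π * I * t * z) = cexp (2 * π * I * t * (z - v)) := by
  rw [← Complex.exp_add]
  congr 1
  ring

theorem integral_exp_neg_eq_sincFun (γ : ℝ) (v : ℂ) :
    ∫ t in (-γ)..γ, cexp (-(2 * π * I * t * v)) = sincFun (2 * γ) v := by
  rw [← sincFun_neg, ← integral_exp_eq_sincFun]
  simp

theorem expTransform_indicator {p : ℝ → ℂ} {β : ℝ} (hβ : 0 ≤ β) (z : ℂ) :
    expTransform ((Icc (-β) β).indicator p) z
      = ∫ t in (-β)..β, p t * cexp (2 * π * I * t * z) := by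
  rw [expTransform, intervalIntegral.integral_of_le (by linarith), ← integral_Icc_eq_integral_Ioc,
    ← integral_indicator measurableSet_Icc]
  refine integral_congr_ae (Eventually.of_forall fun t => ?_)
  by_cases ht : t ∈ Icc (-β) β
  · simp [indicator_of_mem ht]
  · simp [indicator_of_notMem ht]

/-- For t in the support, [t-1, t+1] contains the whole support, so k = e^{-2πitv} + D with D =
½(`sincFun Δ v` + ΔD), that is, D = `sincFun Δ v` / (2 - Δ). -/
theorem smallKernel_reproduces {Δ : ℝ} (hΔ : 0 < Δ) (hΔ1 : Δ ≤ 1) (w : ℂ) :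
    smallKernel Δ w ∈ space Δ ∧ ∀ F ∈ space Δ, F w = innerProd F (smallKernel Δ w) := by
  set v := conj w with hv
  set D : ℂ := 1 / (2 - (Δ : ℂ)) * sincFun Δ v with hD
  set p : ℝ → ℂ := fun t => cexp (-(2 * π * I * t * v)) + D with hp
  have hpc : Continuous p := by fun_prop
  set k : ℝ → ℂ := (Icc (-(Δ / 2)) (Δ / 2)).indicator p with hk
  -- A degenerate gluing with γ = β, which makes the boundedness, integrability and vanishing lemmas
  -- for `glue` available.
  have hkg : k = glue (Δ / 2) (Δ / 2) p p p := by
    ext t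
    simp only [hk, glue]
    congr 1
    ext s
    split_ifs <;> rfl
  obtain ⟨C, -, hC⟩ := glue_bounded (γ := Δ / 2) (β := Δ / 2) hpc hpc hpc
  have hki := integrable_glue (γ := Δ / 2) (β := Δ / 2) hpc hpc hpc
  rw [← hkg] at hC hki
  have hΔ2 : (2 - (Δ : ℂ)) ≠ 0 := by
    have : (2 - Δ : ℝ) ≠ 0 := by linarith
    exact_mod_cast this
  have hmain : ∫ t in (-(Δ / 2))..(Δ / 2), k t = sincFun Δ v + Δ * D := by
    have h1 : ∫ t in (-(Δ / 2))..(Δ / 2), k t = ∫ t in (-(Δ / 2))..(Δ / 2), p t := by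
      refine intervalIntegral.integral_congr fun t ht => ?_
      rw [uIcc_of_le (by linarith)] at ht
      simp [hk, indicator_of_mem ht]
    rw [h1, intervalIntegral.integral_add (Continuous.intervalIntegrable (by fun_prop) _ _)
      (by simp), integral_exp_neg_eq_sincFun]
    simp
    ring_nf
  have hres := mem_space_and_reproduces_of_solution (v := v) hΔ hki hC
    (fun t ht => indicator_of_notMem ht _) fun t ht => ?_
  · have hT : expTransform k = smallKernel Δ w := by
      ext z
      rw [hk, expTransform_indicator (by linarith)]
      simp only [hp, add_mul, exp_mul_exp_sub]
      rw [intervalIntegral.integral_add (Continuous.intervalIntegrable (by fun_prop) _ _)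
        (Continuous.intervalIntegrable (by fun_prop) _ _), intervalIntegral.integral_const_mul,
        integral_exp_eq_sincFun, integral_exp_eq_sincFun, mul_div_cancel₀ _ two_ne_zero,
        smallKernel, hD]
      ring
    rw [hT, hv, conj_conj] at hres
    exact hres
  · have hi : ∀ a b : ℝ, IntervalIntegrable k volume a b := fun a b => hki.intervalIntegrable
    rw [← intervalIntegral.integral_add_adjacent_intervals (hi (t - 1) (-(Δ / 2))) (hi _ (t + 1)),
      ← intervalIntegral.integral_add_adjacent_intervals (hi (-(Δ / 2)) (Δ / 2)) (hi _ (t + 1)),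
      hmain, hkg, integral_glue_eq_zero_of_le (by linarith [ht.2]),
      integral_glue_eq_zero_of_ge (by linarith [ht.1]), ← hkg, hk,
      indicator_of_mem (Ioo_subset_Icc_self ht)]
    simp only [hp, hD]
    field_simp
    ring

/-! ### The case `1 < Δ` -/

/-- Solutions of the coupled delay equations on the outer intervals, glued to the middle piece
under three boundary conditions, solve the integral equation. -/
theorem glue_solves {γ β : ℝ} (hγ : 0 ≤ γ) (hγβ : γ ≤ β) (hsum : γ + β = 1)
    {kL kR : ℝ → ℂ} {D v : ℂ}
    (hL : ∀ t, HasDerivAt (fun t => kL t - cexp (-(2 * π * I * t * v))) (1 / 2 * kR (t + 1)) t)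
    (hR : ∀ t, HasDerivAt (fun t => kR t - cexp (-(2 * π * I * t * v))) (-(1 / 2 * kL (t - 1))) t)
    (hLc : Continuous kL) (hRc : Continuous kR)
    (h1 : kR γ - cexp (-(2 * π * I * γ * v)) = D)
    (h2 : kL (-γ) - cexp (-(2 * π * I * (-γ : ℝ) * v)) = D)
    (h3 : (kR β - cexp (-(2 * π * I * β * v))) + (kL (-β) - cexp (-(2 * π * I * (-β : ℝ) * v)))
      = (2 - β) * D + 1 / 2 * sincFun (2 * γ) v)
    {t : ℝ} (ht : t ∈ Ioo (-β) β) :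
    glue γ β kL (fun t => D + cexp (-(2 * π * I * t * v))) kR t
      - 1 / 2 * ∫ s in (t - 1)..(t + 1),
          glue γ β kL (fun t => D + cexp (-(2 * π * I * t * v))) kR s
      = cexp (-(2 * π * I * t * v)) := by
  set kM : ℝ → ℂ := fun t => D + cexp (-(2 * π * I * t * v)) with hkM
  set e : ℝ → ℂ := fun t => cexp (-(2 * π * I * t * v)) with he
  have hMc : Continuous kM := by fun_prop
  have hmL : kL (-γ) = kM (-γ) := by simp only [hkM]; linear_combination h2
  have hmR : kR γ = kM γ := by simp only [hkM]; linear_combination h1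
  set k := glue γ β kL kM kR with hk
  have hki : ∀ a b : ℝ, IntervalIntegrable k volume a b := fun a b =>
    (integrable_glue hLc hMc hRc).intervalIntegrable
  -- Translation by 1 maps [-β, -γ] onto [γ, β] because γ + β = 1. Half the integral of kL is thus
  -- minus the integral of a derivative in the equation for kR, and only boundary values remain.
  have hleft : ∀ a ∈ Icc (-β) (-γ), 1 / 2 * ∫ s in a..(-γ), k s
      = (kR (a + 1) - e (a + 1 : ℝ)) - (kR β - e β) := by
    intro a ha
    have hc : ∫ s in a..(-γ), k s = ∫ s in a..(-γ), kL s := by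
      refine intervalIntegral.integral_congr fun s hs => ?_
      rw [uIcc_of_le ha.2] at hs
      exact glue_left hγ hγβ hmL ⟨ha.1.trans hs.1, hs.2⟩
    have hs : ∫ s in a..(-γ), kL s = ∫ s in (a + 1)..β, kL (s - 1) := by
      rw [intervalIntegral.integral_comp_sub_right]
      congr 1 <;> linarith
    have hf := intervalIntegral.integral_eq_sub_of_hasDerivAt (a := a + 1) (b := β)
      (fun s _ => hR s) (Continuous.intervalIntegrable (by fun_prop) _ _)
    rw [intervalIntegral.integral_neg, intervalIntegral.integral_const_mul] at hf
    rw [hc, hs]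
    linear_combination -hf
  have hright : ∀ b ∈ Icc γ β, 1 / 2 * ∫ s in γ..b, k s
      = (kL (b - 1) - e (b - 1 : ℝ)) - (kL (-β) - e (-β : ℝ)) := by
    intro b hb
    have hc : ∫ s in γ..b, k s = ∫ s in γ..b, kR s := by
      refine intervalIntegral.integral_congr fun s hs => ?_
      rw [uIcc_of_le hb.1] at hs
      exact glue_right hγ hmR ⟨hs.1, hs.2.trans hb.2⟩
    have hs : ∫ s in γ..b, kR s = ∫ s in (-β)..(b - 1), kR (s + 1) := by
      rw [intervalIntegral.integral_comp_add_right]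
      congr 1 <;> linarith
    have hf := intervalIntegral.integral_eq_sub_of_hasDerivAt (a := -β) (b := b - 1)
      (fun s _ => hL s) (Continuous.intervalIntegrable (by fun_prop) _ _)
    rw [intervalIntegral.integral_const_mul] at hf
    rw [hc, hs]
    linear_combination hf
  have hmid : 1 / 2 * ∫ s in (-γ)..γ, k s = γ * D + 1 / 2 * sincFun (2 * γ) v := by
    have hc : ∫ s in (-γ)..γ, k s = ∫ s in (-γ)..γ, kM s := by
      refine intervalIntegral.integral_congr fun s hs => ?_
      rw [uIcc_of_le (by linarith)] at hs
      exact glue_middle hγβ hs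
    rw [hc, intervalIntegral.integral_add (by simp)
      (Continuous.intervalIntegrable (by fun_prop) _ _), integral_exp_neg_eq_sincFun]
    simp
    ring
  have hsumC : (γ : ℂ) + β = 1 := by exact_mod_cast hsum
  have hsplit : ∀ a b c d : ℝ, ∫ s in a..d, k s
      = (∫ s in a..b, k s) + (∫ s in b..c, k s) + ∫ s in c..d, k s := by
    intro a b c d
    rw [intervalIntegral.integral_add_adjacent_intervals (hki a b) (hki b c),
      intervalIntegral.integral_add_adjacent_intervals (hki a c) (hki c d)]
  have hLfull := hleft (-β) ⟨le_rfl, by linarith⟩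
  have hRfull := hright β ⟨hγβ, le_rfl⟩
  have e1 : -β + 1 = γ := by linarith
  have e2 : β - 1 = -γ := by linarith
  rw [e1] at hLfull
  rw [e2] at hRfull
  -- The window meets the support in [-β, t+1], in all of it, or in [t-1, β]. In the middle case the
  -- equation reads D = 2D + γD + ½S minus the outer boundary values, with S = `sincFun (2 * γ) v`.
  -- This is h3, since 1 + γ = 2 - β; the other two cases reduce to it as well.
  rcases le_total t (-γ) with htL | htL
  · have hz : ∫ s in (t - 1)..(-β), k s = 0 := integral_glue_eq_zero_of_le (by linarith)
    have hr := hright (t + 1) ⟨by linarith [ht.1], by linarith⟩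
    rw [add_sub_cancel_right] at hr
    rw [hsplit (t - 1) (-β) γ (t + 1), hz, hsplit (-β) (-γ) (-γ) γ, intervalIntegral.integral_same]
    rw [show k t = kL t from glue_left hγ hγβ hmL ⟨ht.1.le, htL⟩]
    linear_combination -hLfull - hmid - hr + h3 - h1 - D * hsumC
  · rcases le_total t γ with htR | htR
    · have hz : ∫ s in (t - 1)..(-β), k s = 0 := integral_glue_eq_zero_of_le (by linarith)
      have hz' : ∫ s in β..(t + 1), k s = 0 := integral_glue_eq_zero_of_ge (by linarith)
      rw [hsplit (t - 1) (-β) β (t + 1), hz, hz', hsplit (-β) (-γ) γ β]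
      rw [show k t = kM t from glue_middle hγβ ⟨htL, htR⟩]
      simp only [hkM]
      linear_combination -hLfull - hmid - hRfull + h3 - h1 - h2 - D * hsumC
    · have hz' : ∫ s in β..(t + 1), k s = 0 := integral_glue_eq_zero_of_ge (by linarith)
      have hl := hleft (t - 1) ⟨by linarith, by linarith [ht.2]⟩
      rw [sub_add_cancel] at hl
      rw [hsplit (t - 1) (-γ) β (t + 1), hz', hsplit (-γ) γ γ β, intervalIntegral.integral_same]
      rw [show k t = kR t from glue_right hγ hmR ⟨htR, ht.2.le⟩]
      linear_combination -hl - hmid - hRfull + h3 - h2 - D * hsumC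

theorem expTransform_glue {γ β : ℝ} (hγ : 0 ≤ γ) (hγβ : γ ≤ β) {kL kM kR : ℝ → ℂ}
    (hL : Continuous kL) (hM : Continuous kM) (hR : Continuous kR)
    (hmL : kL (-γ) = kM (-γ)) (hmR : kR γ = kM γ) (z : ℂ) :
    expTransform (glue γ β kL kM kR) z
      = (∫ t in (-β)..(-γ), kL t * cexp (2 * π * I * t * z))
        + (∫ t in (-γ)..γ, kM t * cexp (2 * π * I * t * z))
        + ∫ t in γ..β, kR t * cexp (2 * π * I * t * z) := by
  have hg : glue γ β kL kM kR = (Icc (-β) β).indicator (glue γ β kL kM kR) := by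
    ext t
    by_cases ht : t ∈ Icc (-β) β
    · rw [indicator_of_mem ht]
    · rw [indicator_of_notMem ht, glue_of_notMem ht]
  have hi : ∀ a b : ℝ, IntervalIntegrable
      (fun t : ℝ => glue γ β kL kM kR t * cexp (2 * π * I * t * z)) volume a b := fun a b =>
    (integrable_mul_exp (integrable_glue hL hM hR) (fun t ht => glue_of_notMem ht)
      z).intervalIntegrable
  rw [hg, expTransform_indicator (by linarith),
    ← intervalIntegral.integral_add_adjacent_intervals (hi (-β) γ) (hi γ β),
    ← intervalIntegral.integral_add_adjacent_intervals (hi (-β) (-γ)) (hi (-γ) γ)]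
  congr 1
  · congr 1
    · refine intervalIntegral.integral_congr fun t ht => ?_
      rw [uIcc_of_le (by linarith)] at ht
      simp only [glue_left hγ hγβ hmL ht]
    · refine intervalIntegral.integral_congr fun t ht => ?_
      rw [uIcc_of_le (by linarith)] at ht
      simp only [glue_middle hγβ ht]
  · refine intervalIntegral.integral_congr fun t ht => ?_
    rw [uIcc_of_le hγβ] at ht
    simp only [glue_right hγ hmR ht]

end SpKernel

namespace SpKernel

/-! ### The determinant -/

theorem exp_mul_I_div_four (x : ℝ) :
    cexp (x * I / 4) = Real.cos (x / 4) + Real.sin (x / 4) * I := by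
  have : (x * I / 4 : ℂ) = ((x / 4 : ℝ) : ℂ) * I := by push_cast; ring
  rw [this, Complex.exp_mul_I, ofReal_cos, ofReal_sin]

/-- The determinant is 2i Im(conj(a) b), hence purely imaginary, so only this part matters. It
depends on the angles Δ/4 and (2-Δ)/4 only through their difference. -/
theorem det_im (Δ : ℝ) : (det Δ).im = 2 * (-2 + 2 * Real.sin ((Δ - 1) / 2)
    + (2 * ((2 - Δ) / 4) + 1) * Real.cos ((Δ - 1) / 2)) := by
  have hsub : (Δ - 1) / 2 = Δ / 4 - (2 - Δ) / 4 := by ring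
  rw [hsub, Real.sin_sub, Real.cos_sub]
  have h1 := Real.sin_sq_add_cos_sq (Δ / 4)
  have h2 := Real.sin_sq_add_cos_sq ((2 - Δ) / 4)
  have ha : cexp (Δ * I / 4) = Real.cos (Δ / 4) + Real.sin (Δ / 4) * I := exp_mul_I_div_four Δ
  have hb : cexp ((2 - Δ) * I / 4) = Real.cos ((2 - Δ) / 4) + Real.sin ((2 - Δ) / 4) * I := by
    rw [← exp_mul_I_div_four (2 - Δ)]
    push_cast
    rfl
  have hc : ((2 - Δ) / 4 : ℂ) = ((((2 - Δ) / 4 : ℝ)) : ℂ) := by push_cast; rfl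
  rw [det, constA, constB, tau, ha, hb, hc]
  set c := (2 - Δ) / 4
  set x := Real.cos (Δ / 4)
  set y := Real.sin (Δ / 4)
  set p := Real.cos c
  set q := Real.sin c
  simp only [sub_im, mul_im, mul_re, conj_re, conj_im, add_re, add_im, sub_re, ofReal_re, ofReal_im,
    I_re, I_im]
  linear_combination -2 * h1 - 2 * h2

/-- With θ = (Δ-1)/2, the bounds sin θ < θ and cos θ ≤ 1 make half the imaginary part less than -2 +
(Δ-1) + (2 - Δ/2) = Δ/2 - 1 ≤ 0. -/
theorem det_ne_zero {Δ : ℝ} (h1 : 1 < Δ) (h2 : Δ ≤ 2) : det Δ ≠ 0 := by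
  intro h
  have him := det_im Δ
  rw [h, zero_im] at him
  have hs : Real.sin ((Δ - 1) / 2) < (Δ - 1) / 2 := Real.sin_lt (by linarith)
  have hc := Real.cos_le_one ((Δ - 1) / 2)
  nlinarith

/-! ### The boundary conditions -/

theorem conj_exp_mul_I_div_four (x : ℝ) : conj (cexp (x * I / 4)) = cexp (-(x * I / 4)) := by
  rw [← exp_conj]
  congr 1
  simp only [map_div₀, map_mul, conj_I, conj_ofReal, map_ofNat]
  ring

theorem conj_exp_two_sub_mul_I_div_four (x : ℝ) :
    conj (cexp ((2 - x) * I / 4)) = cexp (-((2 - x) * I / 4)) := by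
  have := conj_exp_mul_I_div_four (2 - x)
  push_cast at this
  exact this

theorem conj_tau (Δ : ℝ) : conj (tau Δ)
    = cexp (-((2 - Δ) * I / 4)) + I * cexp (-(Δ * I / 4)) := by
  rw [tau, map_sub, map_mul, conj_I, conj_exp_mul_I_div_four, conj_exp_two_sub_mul_I_div_four]
  ring

theorem conj_constA (Δ : ℝ) : conj (constA Δ)
    = cexp (-(Δ * I / 4)) + I * cexp (-((2 - Δ) * I / 4)) - I * cexp (-(Δ * I / 4))
      - (2 - Δ) / 4 * conj (tau Δ) := by
  simp only [constA, map_sub, map_add, map_mul, conj_I, conj_exp_mul_I_div_four,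
    conj_exp_two_sub_mul_I_div_four, map_div₀, map_ofNat, conj_ofReal]
  ring

theorem conj_constB (Δ : ℝ) : conj (constB Δ)
    = cexp (-(Δ * I / 4)) + I * cexp (-((2 - Δ) * I / 4)) - cexp (-((2 - Δ) * I / 4))
      - (2 - Δ) / 4 * conj (tau Δ) := by
  simp only [constB, map_sub, map_mul, conj_I, conj_exp_mul_I_div_four,
    conj_exp_two_sub_mul_I_div_four, map_div₀, map_ofNat, conj_ofReal]
  ring

/-- The homogeneous solution on the left interval. -/
def outerL (A B : ℂ) (t : ℝ) : ℂ := A * cexp (I / 2 * t) + B * cexp (-(I / 2 * t))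

/-- The homogeneous solution on the right interval. -/
def outerR (A B : ℂ) (t : ℝ) : ℂ :=
  I * A * cexp (I / 2 * (t - 1)) - I * B * cexp (-(I / 2 * (t - 1)))

theorem continuous_outerL (A B : ℂ) : Continuous (outerL A B) := by
  unfold outerL; fun_prop

theorem continuous_outerR (A B : ℂ) : Continuous (outerR A B) := by
  unfold outerR; fun_prop

/-- Eliminating R from the homogeneous system gives L'' = -L/4, whence the frequencies ±½; R is then
2L'(t-1). -/
theorem hasDerivAt_outerL (A B : ℂ) (t : ℝ) :
    HasDerivAt (outerL A B) (1 / 2 * outerR A B (t + 1)) t := by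
  have h1 : HasDerivAt (fun z : ℂ => I / 2 * z) (I / 2 * 1) (t : ℂ) :=
    (hasDerivAt_id _).const_mul _
  have h2 : HasDerivAt (fun z : ℂ => -(I / 2 * z)) (-(I / 2 * 1)) (t : ℂ) := h1.neg
  have h := ((h1.cexp.const_mul A).add (h2.cexp.const_mul B)).comp_ofReal
  convert! h using 1
  unfold outerR
  push_cast
  rw [add_sub_cancel_right]
  ring

theorem hasDerivAt_outerR (A B : ℂ) (t : ℝ) :
    HasDerivAt (outerR A B) (-(1 / 2 * outerL A B (t - 1))) t := by
  have h1 : HasDerivAt (fun z : ℂ => I / 2 * (z - 1)) (I / 2 * 1) (t : ℂ) :=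
    ((hasDerivAt_id _).sub_const _).const_mul _
  have h2 : HasDerivAt (fun z : ℂ => -(I / 2 * (z - 1))) (-(I / 2 * 1)) (t : ℂ) := h1.neg
  have h := ((h1.cexp.const_mul (I * A)).sub (h2.cexp.const_mul (I * B))).comp_ofReal
  convert! h using 1
  unfold outerL
  push_cast
  linear_combination (-(1 / 2) * A * cexp (I / 2 * (t - 1)) - 1 / 2 * B * cexp (-(I / 2 * (t - 1)))) * I_mul_I

/-- The coefficients solving the boundary conditions, in terms of the boundary values `q₁, q₂` at
the inner end points, the sum `q₃` of those at the outer end points, and the integral `S` over the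
middle interval. -/
theorem boundary_conditions {Δ : ℝ} (hdet : det Δ ≠ 0) {q₁ q₂ q₃ S ρ₁ ρ₂ A B D : ℂ}
    (hρ₁ : ρ₁ = -q₃ + 1 / 2 * S + (1 / 2 + (2 - Δ) / 4) * (q₁ + q₂) + 1 / 2 * (q₁ - q₂))
    (hρ₂ : ρ₂ = -q₃ + 1 / 2 * S + (1 / 2 + (2 - Δ) / 4) * (q₁ + q₂) - 1 / 2 * (q₁ - q₂))
    (hA : A = (constB Δ * ρ₁ - constA Δ * ρ₂) / det Δ)
    (hB : B = (conj (constA Δ) * ρ₂ - conj (constB Δ) * ρ₁) / det Δ)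
    (hD : D = 1 / 2 * (conj (tau Δ) * A + tau Δ * B + (q₁ + q₂))) :
    outerR A B (1 - Δ / 2) + q₁ = D ∧ outerL A B (-(1 - Δ / 2)) + q₂ = D ∧
      outerR A B (Δ / 2) + outerL A B (-(Δ / 2)) + q₃ = (2 - Δ / 2) * D + 1 / 2 * S := by
  -- Cramer's rule. With D the average of the two inner boundary values, two equations remain: e1 -
  -- e2 says that these values agree, and the half-sum of e1 and e2 is the outer condition.
  have e1 : conj (constA Δ) * A + constA Δ * B = ρ₁ := by
    rw [hA, hB]
    field_simp
    rw [det]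
    ring
  have e2 : conj (constB Δ) * A + constB Δ * B = ρ₂ := by
    rw [hA, hB]
    field_simp
    rw [det]
    ring
  have x1 : I / 2 * (((1 - Δ / 2 : ℝ) : ℂ) - 1) = -(Δ * I / 4) := by push_cast; ring
  have x2 : I / 2 * ((-(1 - Δ / 2) : ℝ) : ℂ) = -((2 - Δ) * I / 4) := by push_cast; ring
  have x3 : I / 2 * (((Δ / 2 : ℝ) : ℂ) - 1) = -((2 - Δ) * I / 4) := by push_cast; ring
  have x4 : I / 2 * ((-(Δ / 2) : ℝ) : ℂ) = -(Δ * I / 4) := by push_cast; ring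
  simp only [outerL, outerR, x1, x2, x3, x4, neg_neg]
  rw [conj_constA, constA] at e1
  rw [conj_constB, constB] at e2
  rw [conj_tau] at e1 e2 hD
  rw [tau] at e1 e2 hD
  subst hD
  refine ⟨?_, ?_, ?_⟩
  · linear_combination (-1 / 2 : ℂ) * e1 + 1 / 2 * e2 - 1 / 2 * hρ₁ + 1 / 2 * hρ₂
  · linear_combination (1 / 2 : ℂ) * e1 - 1 / 2 * e2 + 1 / 2 * hρ₁ - 1 / 2 * hρ₂
  · linear_combination (1 / 2 : ℂ) * e1 + 1 / 2 * e2 + 1 / 2 * hρ₁ + 1 / 2 * hρ₂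

/-- The frequency-side solution built from a particular solution `pL, pR` of the delay equations. -/
def largeSolution (Δ : ℝ) (v : ℂ) (pL pR : ℝ → ℂ) (A B D : ℂ) : ℝ → ℂ :=
  glue (1 - Δ / 2) (Δ / 2) (fun t => outerL A B t + pL t)
    (fun t => D + cexp (-(2 * π * I * t * v))) (fun t => outerR A B t + pR t)

section largeSolution

variable {Δ : ℝ} {v : ℂ} {pL pR : ℝ → ℂ} {A B D q₁ q₂ q₃ : ℂ}

/-- Superposition: the particular solution carries the forcing, the homogeneous part adjusts its
boundary values q₁, q₂, q₃. -/
theorem largeSolution_reproduces (h1 : 1 < Δ) (h2 : Δ ≤ 2)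
    (hL : ∀ t, HasDerivAt (fun t => pL t - cexp (-(2 * π * I * t * v))) (1 / 2 * pR (t + 1)) t)
    (hR : ∀ t, HasDerivAt (fun t => pR t - cexp (-(2 * π * I * t * v))) (-(1 / 2 * pL (t - 1))) t)
    (hLc : Continuous pL) (hRc : Continuous pR)
    (hq₁ : q₁ = pR (1 - Δ / 2) - cexp (-(2 * π * I * (1 - Δ / 2 : ℝ) * v)))
    (hq₂ : q₂ = pL (-(1 - Δ / 2)) - cexp (-(2 * π * I * (-(1 - Δ / 2) : ℝ) * v)))
    (hq₃ : q₃ = (pR (Δ / 2) - cexp (-(2 * π * I * (Δ / 2 : ℝ) * v)))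
      + (pL (-(Δ / 2)) - cexp (-(2 * π * I * (-(Δ / 2) : ℝ) * v))))
    (hbc : outerR A B (1 - Δ / 2) + q₁ = D ∧ outerL A B (-(1 - Δ / 2)) + q₂ = D ∧
      outerR A B (Δ / 2) + outerL A B (-(Δ / 2)) + q₃
        = (2 - Δ / 2) * D + 1 / 2 * sincFun (2 - Δ) v) :
    expTransform (largeSolution Δ v pL pR A B D) ∈ space Δ ∧
      ∀ F ∈ space Δ, F (conj v) = innerProd F (expTransform (largeSolution Δ v pL pR A B D)) := by
  have hLc' : Continuous fun t => outerL A B t + pL t := (continuous_outerL A B).add hLc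
  have hRc' : Continuous fun t => outerR A B t + pR t := (continuous_outerR A B).add hRc
  have hMc : Continuous fun t : ℝ => D + cexp (-(2 * π * I * t * v)) := by fun_prop
  obtain ⟨C, -, hC⟩ := glue_bounded (γ := 1 - Δ / 2) (β := Δ / 2) hLc' hMc hRc'
  obtain ⟨b1, b2, b3⟩ := hbc
  refine mem_space_and_reproduces_of_solution (by linarith) (integrable_glue hLc' hMc hRc') hC
    (fun t ht => glue_of_notMem ht) fun t ht => ?_
  refine glue_solves (by linarith) (by linarith) (by ring) (fun t => ?_) (fun t => ?_) hLc' hRc'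
    ?_ ?_ ?_ ht
  · have := (hasDerivAt_outerL A B t).add (hL t)
    convert! this using 1
    · ext s; simp only [Pi.add_apply]; ring
    · ring
  · have := (hasDerivAt_outerR A B t).add (hR t)
    convert! this using 1
    · ext s; simp only [Pi.add_apply]; ring
    · ring
  · linear_combination b1 - hq₁
  · linear_combination b2 - hq₂
  · have : 2 * (1 - Δ / 2) = 2 - Δ := by ring
    rw [this]
    push_cast at *
    linear_combination b3 - hq₃

/-- Moving the right interval onto the left one by a unit shift multiplies by e^{2πiz}, and the two
outer contributions combine into the factors 1 ± i e^{2πiz}. -/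
theorem expTransform_largeSolution (h1 : 1 < Δ) (h2 : Δ ≤ 2)
    (hLc : Continuous pL) (hRc : Continuous pR)
    (hq₁ : q₁ = pR (1 - Δ / 2) - cexp (-(2 * π * I * (1 - Δ / 2 : ℝ) * v)))
    (hq₂ : q₂ = pL (-(1 - Δ / 2)) - cexp (-(2 * π * I * (-(1 - Δ / 2) : ℝ) * v)))
    (b1 : outerR A B (1 - Δ / 2) + q₁ = D) (b2 : outerL A B (-(1 - Δ / 2)) + q₂ = D) (z : ℂ) :
    expTransform (largeSolution Δ v pL pR A B D) z
      = A * (-I * cexp (2 * π * I * z) - 1) * (expQuot (-Δ) (-(2 - Δ)) (π * I * z + I / 4) / 2)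
        + B * (I * cexp (2 * π * I * z) - 1) * (expQuot (-Δ) (-(2 - Δ)) (π * I * z - I / 4) / 2)
        + ((∫ t in (-(Δ / 2))..(-(1 - Δ / 2)), pL t * cexp (2 * π * I * t * z))
          + ∫ t in (1 - Δ / 2)..(Δ / 2), pR t * cexp (2 * π * I * t * z))
        + D * sincFun (2 - Δ) z + sincFun (2 - Δ) (z - v) := by
  have hLc' : Continuous fun t => outerL A B t + pL t := (continuous_outerL A B).add hLc
  have hRc' : Continuous fun t => outerR A B t + pR t := (continuous_outerR A B).add hRc
  have hMc : Continuous fun t : ℝ => D + cexp (-(2 * π * I * t * v)) := by fun_prop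
  have hoL := continuous_outerL A B
  have hoR := continuous_outerR A B
  have hci : ∀ {p : ℝ → ℂ} (a b : ℝ), Continuous p → IntervalIntegrable p volume a b :=
    fun a b hp => hp.intervalIntegrable a b
  rw [largeSolution, expTransform_glue (by linarith) (by linarith) hLc' hMc hRc'
    (by linear_combination b2 - hq₂) (by linear_combination b1 - hq₁)]
  simp only [add_mul, exp_mul_exp_sub]
  rw [intervalIntegral.integral_add (hci _ _ (by fun_prop)) (hci _ _ (by fun_prop)),
    intervalIntegral.integral_add (hci _ _ (by fun_prop)) (hci _ _ (by fun_prop)),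
    intervalIntegral.integral_add (hci _ _ (by fun_prop)) (hci _ _ (by fun_prop)),
    intervalIntegral.integral_const_mul, integral_exp_eq_sincFun, integral_exp_eq_sincFun]
  have e0 : 2 * (1 - Δ / 2) = 2 - Δ := by ring
  rw [e0]
  have hshift : ∫ t in (1 - Δ / 2)..(Δ / 2), outerR A B t * cexp (2 * π * I * t * z)
      = ∫ t in (-(Δ / 2))..(-(1 - Δ / 2)),
        outerR A B (t + 1) * cexp (2 * π * I * (t + 1 : ℝ) * z) := by
    rw [intervalIntegral.integral_comp_add_right
      (fun t => outerR A B t * cexp (2 * π * I * t * z))]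
    congr 1 <;> ring
  have hI : ∀ ζ : ℂ, ∫ t in (-(Δ / 2))..(-(1 - Δ / 2)), cexp (2 * t * ζ)
      = -(expQuot (-Δ) (-(2 - Δ)) ζ / 2) := by
    intro ζ
    rw [integral_exp_mul, expQuot_neg_swap, neg_div]
    have e1 : 2 * -(Δ / 2) = -Δ := by ring
    have e2 : 2 * -(1 - Δ / 2) = -(2 - Δ) := by ring
    rw [e1, e2]
  have hout : (∫ t in (-(Δ / 2))..(-(1 - Δ / 2)), outerL A B t * cexp (2 * π * I * t * z))
      + ∫ t in (1 - Δ / 2)..(Δ / 2), outerR A B t * cexp (2 * π * I * t * z)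
      = A * (-I * cexp (2 * π * I * z) - 1) * (expQuot (-Δ) (-(2 - Δ)) (π * I * z + I / 4) / 2)
        + B * (I * cexp (2 * π * I * z) - 1)
          * (expQuot (-Δ) (-(2 - Δ)) (π * I * z - I / 4) / 2) := by
    have c1 : Continuous fun t : ℝ => outerL A B t * cexp (2 * π * I * t * z) := by fun_prop
    have c2 : Continuous fun t : ℝ =>
        outerR A B (t + 1) * cexp (2 * π * I * (t + 1 : ℝ) * z) := by fun_prop
    rw [hshift, ← intervalIntegral.integral_add (hci _ _ c1) (hci _ _ c2)]
    have hcongr : ∀ t : ℝ, outerL A B t * cexp (2 * π * I * t * z)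
        + outerR A B (t + 1) * cexp (2 * π * I * (t + 1 : ℝ) * z)
        = A * (1 + I * cexp (2 * π * I * z)) * cexp (2 * t * (π * I * z + I / 4))
          + B * (1 - I * cexp (2 * π * I * z)) * cexp (2 * t * (π * I * z - I / 4)) := by
      intro t
      have y1 : cexp (2 * t * (π * I * z + I / 4)) = cexp (I / 2 * t) * cexp (2 * π * I * t * z) := by
        rw [← Complex.exp_add]; congr 1; ring
      have y2 : cexp (2 * t * (π * I * z - I / 4))
          = cexp (-(I / 2 * t)) * cexp (2 * π * I * t * z) := by
        rw [← Complex.exp_add]; congr 1; ring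
      have y3 : cexp (2 * π * I * (t + 1 : ℝ) * z)
          = cexp (2 * π * I * t * z) * cexp (2 * π * I * z) := by
        rw [← Complex.exp_add]; congr 1; push_cast; ring
      rw [y1, y2, y3, outerL, outerR]
      push_cast
      rw [add_sub_cancel_right]
      ring
    simp_rw [hcongr]
    rw [intervalIntegral.integral_add (hci _ _ (by fun_prop)) (hci _ _ (by fun_prop)),
      intervalIntegral.integral_const_mul, intervalIntegral.integral_const_mul, hI, hI]
    ring
  linear_combination hout

end largeSolution

end SpKernel

namespace SpKernel

/-! ### Conjugates of the auxiliary functions -/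

theorem conj_sincFun (c : ℝ) (w : ℂ) : conj (sincFun c w) = sincFun c (conj w) := by
  unfold sincFun
  by_cases hw : w = 0
  · simp [hw]
  · rw [if_neg hw, if_neg (by simpa using hw)]
    simp only [map_div₀, map_mul, ← sin_conj, conj_ofReal]

theorem conj_funC (w : ℂ) : conj (funC w)
    = (-16 * π ^ 2 * conj w ^ 2 - 4 * π * I * conj w * cexp (-(2 * π * I * conj w)))
      / (1 - 16 * π ^ 2 * conj w ^ 2) := by
  simp only [funC, map_div₀, map_add, map_sub, map_neg, map_mul, map_pow, map_one, map_ofNat,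
    conj_I, conj_ofReal, ← exp_conj]
  have : 2 * (π : ℂ) * -I * conj w = -(2 * π * I * conj w) := by ring
  rw [this]
  ring

theorem two_mul_cos_eq (z : ℂ) : 2 * Complex.cos z = cexp (I * z) + cexp (-(I * z)) := by
  rw [Complex.cos, mul_div_cancel₀ _ two_ne_zero, mul_comm z I, neg_mul, mul_comm z I]

theorem two_mul_sin_eq (z : ℂ) : 2 * Complex.sin z = (cexp (-(I * z)) - cexp (I * z)) * I := by
  rw [Complex.sin, mul_div_cancel₀ _ two_ne_zero, mul_comm z I, neg_mul, mul_comm z I]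

theorem funF_eq (Δ : ℝ) (v : ℂ) : funF Δ v
    = (cexp (π * I * (2 - Δ) * v) + cexp (-(π * I * (2 - Δ) * v))
        - 4 * π * I * v * (cexp (π * I * Δ * v) - cexp (-(π * I * Δ * v))))
      / (1 - 16 * π ^ 2 * v ^ 2) := by
  have h1 := two_mul_cos_eq (π * (2 - Δ) * v)
  have h2 := two_mul_sin_eq (π * Δ * v)
  have e1 : I * (π * (2 - Δ) * v) = π * I * (2 - Δ) * v := by ring
  have e2 : I * (π * Δ * v) = π * I * Δ * v := by ring
  rw [e1] at h1
  rw [e2] at h2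
  rw [funF]
  congr 1
  linear_combination h1 + 4 * π * v * h2

theorem conj_funF (Δ : ℝ) (w : ℂ) : conj (funF Δ w) = funF Δ (conj w) := by
  simp only [funF, map_div₀, map_add, map_sub, map_mul, map_pow, map_one, map_ofNat,
    conj_ofReal, ← cos_conj, ← sin_conj]

theorem funG_eq (Δ : ℝ) (v : ℂ) : funG Δ v
    = (cexp (π * I * Δ * v) + cexp (-(π * I * Δ * v))
        - 4 * π * I * v * cexp (-(π * I * Δ * v)) - cexp (π * I * (2 - Δ) * v))
      / (1 - 16 * π ^ 2 * v ^ 2)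
      + sincFun (2 - Δ) v / (2 * (1 - 16 * π ^ 2 * v ^ 2)) - (2 - Δ) / 4 * funF Δ v := by
  have h1 := two_mul_cos_eq (π * Δ * v)
  have e1 : I * (π * Δ * v) = π * I * Δ * v := by ring
  have e2 : π * Δ * I * v = π * I * Δ * v := by ring
  have e3 : π * (2 - Δ) * I * v = π * I * (2 - Δ) * v := by ring
  rw [e1] at h1
  rw [funG, e2, e3, h1]

theorem conj_funG (Δ : ℝ) (w : ℂ) : conj (funG Δ w)
    = (cexp (π * I * Δ * conj w) + cexp (-(π * I * Δ * conj w))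
        + 4 * π * I * conj w * cexp (π * I * Δ * conj w) - cexp (-(π * I * (2 - Δ) * conj w)))
      / (1 - 16 * π ^ 2 * conj w ^ 2)
      + sincFun (2 - Δ) (conj w) / (2 * (1 - 16 * π ^ 2 * conj w ^ 2))
      - (2 - Δ) / 4 * funF Δ (conj w) := by
  rw [funG_eq]
  simp only [map_div₀, map_add, map_sub, map_neg, map_mul, map_pow, map_one, map_ofNat,
    conj_I, conj_ofReal, ← exp_conj, conj_sincFun, conj_funF]
  have e1 : (π : ℂ) * -I * Δ * conj w = -(π * I * Δ * conj w) := by ring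
  have e2 : (π : ℂ) * -I * (2 - Δ) * conj w = -(π * I * (2 - Δ) * conj w) := by ring
  rw [e1, e2, neg_neg]
  ring

theorem conj_det (Δ : ℝ) : conj (det Δ) = -det Δ := by
  simp only [det, map_sub, map_mul, conj_conj]
  ring

/-- Conjugation flips the sign of the purely imaginary `det` and yields the Cramer form of
`boundary_conditions`, with ρ₁ = conj(G(w)) and ρ₂ = G(conj w). -/
theorem conj_funA (Δ : ℝ) (w : ℂ) : conj (funA Δ w)
    = (constB Δ * conj (funG Δ w) - constA Δ * funG Δ (conj w)) / det Δ := by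
  rw [funA, map_div₀, conj_det]
  simp only [map_sub, map_mul, conj_conj]
  rw [div_neg, ← neg_div]
  congr 1
  ring

theorem conj_funB (Δ : ℝ) (w : ℂ) : conj (funB Δ w)
    = (conj (constA Δ) * funG Δ (conj w) - conj (constB Δ) * conj (funG Δ w)) / det Δ := by
  rw [funB, map_div₀, conj_det]
  simp only [map_sub, map_mul, conj_conj]
  rw [div_neg, ← neg_div]
  congr 1
  ring

theorem conj_funD (Δ : ℝ) (w : ℂ) : conj (funD Δ w)
    = 1 / 2 * (conj (tau Δ) * conj (funA Δ w) + tau Δ * conj (funB Δ w) - funF Δ (conj w)) := by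
  simp only [funD, map_sub, map_add, map_mul, map_div₀, conj_conj, map_one, map_ofNat, conj_funF]

/-! ### The generic points -/

theorem hasDerivAt_cexp_neg (v : ℂ) (t : ℝ) :
    HasDerivAt (fun t : ℝ => cexp (-(2 * π * I * t * v)))
      (-(2 * π * I * v) * cexp (-(2 * π * I * t * v))) t := by
  have h1 : HasDerivAt (fun z : ℂ => -(2 * π * I * z * v)) (-(2 * π * I * 1 * v)) (t : ℂ) :=
    (((hasDerivAt_id _).const_mul _).mul_const _).neg
  convert! h1.cexp.comp_ofReal using 1
  ring

theorem one_sub_ne_zero {w : ℂ} (h1 : w ≠ 1 / (4 * π)) (h2 : w ≠ -1 / (4 * π)) :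
    1 - 16 * (π : ℂ) ^ 2 * conj w ^ 2 ≠ 0 := by
  have hpi : (π : ℂ) ≠ 0 := by exact_mod_cast Real.pi_ne_zero
  intro h
  have h3 := congrArg conj h
  simp only [map_sub, map_mul, map_pow, map_one, map_ofNat, conj_ofReal, conj_conj, map_zero] at h3
  have h4 : (1 - 4 * π * w) * (1 + 4 * π * w) = 0 := by linear_combination h3
  rcases mul_eq_zero.1 h4 with h5 | h5
  · exact h1 (by rw [eq_div_iff (by simp)]; linear_combination -h5)
  · exact h2 (by rw [eq_div_iff (by simp)]; linear_combination h5)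

/-- The functions in the formula are boundary data of the particular solution: q₁ + q₂ = -F(v), and
G(v), conj(G(w)) are the right-hand sides of the two linear equations for the homogeneous
coefficients. -/
theorem explicitKernel_reproduces {Δ : ℝ} (hΔ1 : 1 < Δ) (hΔ2 : Δ ≤ 2) {w : ℂ}
    (hw1 : w ≠ 1 / (4 * π)) (hw2 : w ≠ -1 / (4 * π)) :
    explicitKernel Δ w ∈ space Δ ∧ ∀ F ∈ space Δ, F w = innerProd F (explicitKernel Δ w) := by
  have hden := one_sub_ne_zero hw1 hw2
  have hG1 := conj_funG Δ w
  have hC2 := conj_funC w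
  have hA := conj_funA Δ w
  have hB := conj_funB Δ w
  have hD := conj_funD Δ w
  set v := conj w with hv
  have hwv : w = conj v := by simp [hv]
  have hG2 := funG_eq Δ v
  have hC1 : funC v = (-16 * π ^ 2 * v ^ 2 + 4 * π * I * v * cexp (2 * π * I * v))
      / (1 - 16 * π ^ 2 * v ^ 2) := rfl
  have hF := funF_eq Δ v
  set u := (1 - 16 * (π : ℂ) ^ 2 * v ^ 2)⁻¹ with hu
  have hu1 : u * (1 - 16 * (π : ℂ) ^ 2 * v ^ 2) = 1 := inv_mul_cancel₀ hden
  set S := sincFun (2 - Δ) v with hS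
  have hs : S * (2 * π * I * v) = cexp (π * I * (2 - Δ) * v) - cexp (-(π * I * (2 - Δ) * v)) := by
    have := sincFun_mul (2 - Δ) v
    push_cast at this
    exact this
  have hE : cexp (2 * π * I * v) = cexp (π * I * Δ * v) * cexp (π * I * (2 - Δ) * v) := by
    rw [← Complex.exp_add]; congr 1; ring
  have hE' : cexp (-(2 * π * I * v)) = cexp (-(π * I * Δ * v)) * cexp (-(π * I * (2 - Δ) * v)) := by
    rw [← Complex.exp_add]; congr 1; ring
  have hx : cexp (π * I * Δ * v) * cexp (-(π * I * Δ * v)) = 1 := by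
    rw [← Complex.exp_add, add_neg_cancel, Complex.exp_zero]
  have hy : cexp (π * I * (2 - Δ) * v) * cexp (-(π * I * (2 - Δ) * v)) = 1 := by
    rw [← Complex.exp_add, add_neg_cancel, Complex.exp_zero]
  have hEE : cexp (2 * π * I * v) * cexp (-(2 * π * I * v)) = 1 := by
    rw [← Complex.exp_add, add_neg_cancel, Complex.exp_zero]
  have hC1' : funC v - 1 = u * (-1 + 4 * π * I * v * cexp (2 * π * I * v)) := by
    rw [hC1, div_eq_mul_inv, ← hu]
    linear_combination hu1
  have hC2' : conj (funC w) - 1 = u * (-1 - 4 * π * I * v * cexp (-(2 * π * I * v))) := by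
    rw [hC2, div_eq_mul_inv, ← hu]
    linear_combination hu1
  rw [div_eq_mul_inv, ← hu] at hC1 hC2 hF
  rw [div_eq_mul_inv, div_eq_mul_inv, mul_inv, ← hu] at hG1 hG2
  -- Multiples of e^{-2πitv} on the two sides satisfy the forced system when their coefficients
  -- solve a 2×2 linear system of determinant (1 - 16π²v²)/4; the solution is conj(C(w)) on the left
  -- and C(v) on the right.
  set pL : ℝ → ℂ := fun t => conj (funC w) * cexp (-(2 * π * I * t * v)) with hpL
  set pR : ℝ → ℂ := fun t => funC v * cexp (-(2 * π * I * t * v)) with hpR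
  have hLc : Continuous pL := by fun_prop
  have hRc : Continuous pR := by fun_prop
  have hderL : ∀ t, HasDerivAt (fun t => pL t - cexp (-(2 * π * I * t * v)))
      (1 / 2 * pR (t + 1)) t := by
    intro t
    convert! ((hasDerivAt_cexp_neg v t).const_mul (conj (funC w))).sub (hasDerivAt_cexp_neg v t)
      using 1
    have h1 : cexp (-(2 * π * I * (t + 1 : ℝ) * v))
        = cexp (-(2 * π * I * t * v)) * cexp (-(2 * π * I * v)) := by
      rw [← Complex.exp_add]; congr 1; push_cast; ring
    simp only [hpR]
    rw [h1, hC1]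
    linear_combination (2 * π * I * v * cexp (-(2 * π * I * t * v))) * hC2'
      + (2 * π * I * v * u * cexp (-(2 * π * I * t * v))) * hEE
      - 8 * π ^ 2 * v ^ 2 * u * cexp (-(2 * π * I * t * v)) * cexp (-(2 * π * I * v)) * I_sq
  have hderR : ∀ t, HasDerivAt (fun t => pR t - cexp (-(2 * π * I * t * v)))
      (-(1 / 2 * pL (t - 1))) t := by
    intro t
    convert! ((hasDerivAt_cexp_neg v t).const_mul (funC v)).sub (hasDerivAt_cexp_neg v t)
      using 1
    have h1 : cexp (-(2 * π * I * (t - 1 : ℝ) * v))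
        = cexp (-(2 * π * I * t * v)) * cexp (2 * π * I * v) := by
      rw [← Complex.exp_add]; congr 1; push_cast; ring
    simp only [hpL]
    rw [h1, hC2]
    linear_combination (2 * π * I * v * cexp (-(2 * π * I * t * v))) * hC1'
      + (2 * π * I * v * u * cexp (-(2 * π * I * t * v))) * hEE
      + 8 * π ^ 2 * v ^ 2 * u * cexp (-(2 * π * I * t * v)) * cexp (2 * π * I * v) * I_sq
  have x1 : cexp (-(2 * π * I * (1 - Δ / 2 : ℝ) * v)) = cexp (-(π * I * (2 - Δ) * v)) := by
    congr 1; push_cast; ring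
  have x2 : cexp (-(2 * π * I * (-(1 - Δ / 2) : ℝ) * v)) = cexp (π * I * (2 - Δ) * v) := by
    congr 1; push_cast; ring
  have x3 : cexp (-(2 * π * I * (Δ / 2 : ℝ) * v)) = cexp (-(π * I * Δ * v)) := by
    congr 1; push_cast; ring
  have x4 : cexp (-(2 * π * I * (-(Δ / 2) : ℝ) * v)) = cexp (π * I * Δ * v) := by
    congr 1; push_cast; ring
  -- In these variables the boundary identities are polynomial, modulo XX' = YY' = 1, u(1 - 16π²v²)
  -- = 1, I² = -1 and S · 2πiv = Y - Y'.
  set X := cexp (π * I * Δ * v)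
  set X' := cexp (-(π * I * Δ * v))
  set Y := cexp (π * I * (2 - Δ) * v)
  set Y' := cexp (-(π * I * (2 - Δ) * v))
  rw [hE] at hC1'
  rw [hE'] at hC2'
  have hbc := boundary_conditions (Δ := Δ) (det_ne_zero hΔ1 hΔ2)
    (q₁ := (funC v - 1) * Y') (q₂ := (conj (funC w) - 1) * Y)
    (q₃ := (funC v - 1) * X' + (conj (funC w) - 1) * X) (S := S)
    (ρ₁ := conj (funG Δ w)) (ρ₂ := funG Δ v) (A := conj (funA Δ w)) (B := conj (funB Δ w))
    (D := conj (funD Δ w)) ?_ ?_ hA hB ?_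
  · have hq₁ : (funC v - 1) * Y' = pR (1 - Δ / 2) - cexp (-(2 * π * I * (1 - Δ / 2 : ℝ) * v)) := by
      simp only [hpR]
      rw [x1]; ring
    have hq₂ : (conj (funC w) - 1) * Y
        = pL (-(1 - Δ / 2)) - cexp (-(2 * π * I * (-(1 - Δ / 2) : ℝ) * v)) := by
      simp only [hpL]
      rw [x2]; ring
    have hq₃ : (funC v - 1) * X' + (conj (funC w) - 1) * X
        = (pR (Δ / 2) - cexp (-(2 * π * I * (Δ / 2 : ℝ) * v)))
          + (pL (-(Δ / 2)) - cexp (-(2 * π * I * (-(Δ / 2) : ℝ) * v))) := by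
      simp only [hpL, hpR]
      rw [x3, x4]; ring
    have hrep := largeSolution_reproduces hΔ1 hΔ2 hderL hderR hLc hRc hq₁ hq₂ hq₃ hbc
    have hT : expTransform (largeSolution Δ v pL pR (conj (funA Δ w)) (conj (funB Δ w))
        (conj (funD Δ w))) = explicitKernel Δ w := by
      ext z
      rw [expTransform_largeSolution hΔ1 hΔ2 hLc hRc hq₁ hq₂ hbc.1 hbc.2.1]
      have hz : ∀ t : ℝ, cexp (2 * π * I * t * (z - v)) = cexp (2 * t * (π * I * (z - v))) :=
        fun t => by congr 1; ring
      have e1 : 2 * -(1 - Δ / 2) = -(2 - Δ) := by ring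
      have e2 : 2 * -(Δ / 2) = -Δ := by ring
      have e3 : 2 * (Δ / 2) = Δ := by ring
      have e4 : 2 * (1 - Δ / 2) = 2 - Δ := by ring
      simp only [hpL, hpR, mul_assoc (conj (funC w)), mul_assoc (funC v), exp_mul_exp_sub, hz,
        intervalIntegral.integral_const_mul, integral_exp_mul, e1, e2, e3, e4]
      rw [explicitKernel, ← hv]
      ring
    rw [hT, ← hwv] at hrep
    exact hrep
  · rw [hG1, hF, hC1', hC2']
    linear_combination 4 * π * I * v * u * (Y - Y') * hx - 4 * π * I * v * u * X * hy + S / 2 * hu1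
      - 4 * π * I * v * u * hs + 8 * π ^ 2 * v ^ 2 * u * S * I_sq
        + (2 - Δ) / 4 * (4 * π * I * v * u) * (X' - X) * hy
  · rw [hG2, hF, hC1', hC2']
    linear_combination 4 * π * I * v * u * (Y - Y') * hx + 4 * π * I * v * u * X' * hy + S / 2 * hu1
      - 4 * π * I * v * u * hs + 8 * π ^ 2 * v ^ 2 * u * S * I_sq
        + (2 - Δ) / 4 * (4 * π * I * v * u) * (X' - X) * hy
  · rw [hD, hF, hC1', hC2']
    linear_combination 1 / 2 * (4 * π * I * v * u) * (X' - X) * hy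

/-! ### The resonant points -/

/-- Here e^{-2πitv} = e^{-ist/2} with s = ±1 solves the homogeneous system, so the particular
solution is sought as the exponential times a polynomial of degree one. -/
theorem exists_reproducing_of_resonance {Δ : ℝ} (hΔ1 : 1 < Δ) (hΔ2 : Δ ≤ 2) {s w : ℂ}
    (hs : s ^ 2 = 1) (hw : conj w = s / (4 * π)) :
    ∃ H ∈ space Δ, ∀ F ∈ space Δ, F w = innerProd F H := by
  have hpi : (π : ℂ) ≠ 0 := by exact_mod_cast Real.pi_ne_zero
  set v := conj w with hv
  have hwv : w = conj v := by simp [hv]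
  have hv2 : 2 * π * I * v = I * s / 2 := by
    rw [hw]
    field_simp
    ring
  set E := cexp (I * s / 2) with hE
  set E' := cexp (-(I * s / 2)) with hE'
  have hEE : E * E' = 1 := by rw [hE, hE', ← Complex.exp_add, add_neg_cancel, Complex.exp_zero]
  have hIs : (I * s) ^ 2 = -1 := by rw [mul_pow, hs, I_sq, mul_one]
  -- Adding a homogeneous solution normalizes the constant term of pR to 1, cancelling the forcing
  -- there. The equation for pR then gives δ and ν in terms of μ, and the equation for pL determines
  -- μ.
  set μ : ℂ := -(I * s) * (1 - I * s * E) / 4 with hμ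
  have hμ2 : 2 * (I * s) * μ = 1 / 2 * (1 - I * s * E) := by
    rw [hμ]
    linear_combination (-1 / 2 * (1 - I * s * E)) * hIs
  set δ : ℂ := I * s * μ * E' with hδ
  set ν : ℂ := (I * s - 2) * μ * E' with hν
  set pL : ℝ → ℂ := fun t => (ν + δ * t) * cexp (-(2 * π * I * t * v)) with hpL
  set pR : ℝ → ℂ := fun t => (1 + μ * t) * cexp (-(2 * π * I * t * v)) with hpR
  have hlin : ∀ (a b : ℂ) (t : ℝ), HasDerivAt (fun t : ℝ => a + b * (t : ℂ)) b t := by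
    intro a b t
    have h := (((hasDerivAt_id (t : ℂ)).const_mul b).const_add a).comp_ofReal
    simpa using h
  have hLc : Continuous pL := by fun_prop
  have hRc : Continuous pR := by fun_prop
  have hderL : ∀ t, HasDerivAt (fun t => pL t - cexp (-(2 * π * I * t * v)))
      (1 / 2 * pR (t + 1)) t := by
    intro t
    convert! ((hlin ν δ t).mul (hasDerivAt_cexp_neg v t)).sub (hasDerivAt_cexp_neg v t) using 1
    have h1 : cexp (-(2 * π * I * (t + 1 : ℝ) * v)) = cexp (-(2 * π * I * t * v)) * E' := by
      rw [hE', ← hv2, ← Complex.exp_add]; congr 1; push_cast; ring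
    simp only [hpR]
    rw [h1, hv2]
    push_cast
    generalize cexp (-(2 * π * I * t * v)) = e
    rw [hν, hδ]
    linear_combination e * (1 / 2 * μ * E' * (1 + t)) * hIs - e * E' * hμ2
      + 1 / 2 * e * (I * s) * hEE
  have hderR : ∀ t, HasDerivAt (fun t => pR t - cexp (-(2 * π * I * t * v)))
      (-(1 / 2 * pL (t - 1))) t := by
    intro t
    convert! ((hlin 1 μ t).mul (hasDerivAt_cexp_neg v t)).sub (hasDerivAt_cexp_neg v t) using 1
    have h1 : cexp (-(2 * π * I * (t - 1 : ℝ) * v)) = cexp (-(2 * π * I * t * v)) * E := by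
      rw [hE, ← hv2, ← Complex.exp_add]; congr 1; push_cast; ring
    simp only [hpL]
    rw [h1, hv2]
    push_cast
    generalize cexp (-(2 * π * I * t * v)) = e
    rw [hν, hδ]
    linear_combination (-(1 / 2) * e * (I * s - 2 + I * s * (t - 1)) * μ) * hEE
  have hbc := boundary_conditions (Δ := Δ) (det_ne_zero hΔ1 hΔ2)
    (q₁ := pR (1 - Δ / 2) - cexp (-(2 * π * I * (1 - Δ / 2 : ℝ) * v)))
    (q₂ := pL (-(1 - Δ / 2)) - cexp (-(2 * π * I * (-(1 - Δ / 2) : ℝ) * v)))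
    (q₃ := (pR (Δ / 2) - cexp (-(2 * π * I * (Δ / 2 : ℝ) * v)))
      + (pL (-(Δ / 2)) - cexp (-(2 * π * I * (-(Δ / 2) : ℝ) * v))))
    (S := sincFun (2 - Δ) v) rfl rfl rfl rfl rfl
  have hrep := largeSolution_reproduces hΔ1 hΔ2 hderL hderR hLc hRc rfl rfl rfl hbc
  rw [← hwv] at hrep
  exact ⟨_, hrep⟩

theorem exists_reproducing {Δ : ℝ} (hΔ0 : 0 < Δ) (hΔ2 : Δ ≤ 2) (w : ℂ) :
    ∃ H ∈ space Δ, ∀ F ∈ space Δ, F w = innerProd F H := by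
  rcases le_or_gt Δ 1 with h | h
  · exact ⟨_, smallKernel_reproduces hΔ0 h w⟩
  · by_cases h1 : w = 1 / (4 * π)
    · refine exists_reproducing_of_resonance h hΔ2 (s := 1) (by norm_num) ?_
      simp [h1, conj_ofNat]
    · by_cases h2 : w = -1 / (4 * π)
      · refine exists_reproducing_of_resonance h hΔ2 (s := -1) (by norm_num) ?_
        simp [h2, conj_ofNat]
      · exact ⟨_, explicitKernel_reproduces h hΔ2 h1 h2⟩

/-! ### Uniqueness and symmetry -/

theorem conj_innerProd (F H : ℂ → ℂ) : conj (innerProd F H) = innerProd H F := by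
  rw [innerProd, innerProd, ← integral_conj]
  refine integral_congr_ae (Eventually.of_forall fun x => ?_)
  simp only [map_mul, conj_conj, conj_ofReal]
  ring

/-- H(z) = ⟨H, K_z⟩ = conj(K_z(w)) = conj⟨K_z, K_w⟩ = K_w(z). Only Hermitian symmetry enters,
neither completeness nor definiteness. -/
theorem IsReproducingKernel.eq_of_reproduces {Δ : ℝ} {K : ℂ → ℂ → ℂ}
    (hK : IsReproducingKernel Δ K) {w : ℂ} {H : ℂ → ℂ} (hH : H ∈ space Δ)
    (h : ∀ F ∈ space Δ, F w = innerProd F H) : K w = H := by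
  ext z
  rw [(hK z).2 H hH, ← conj_innerProd, ← h _ (hK z).1, (hK z).2 _ (hK w).1, ← conj_innerProd,
    ← (hK w).2 _ (hK z).1]

theorem IsReproducingKernel.conj_symm {Δ : ℝ} {K : ℂ → ℂ → ℂ}
    (hK : IsReproducingKernel Δ K) (w z : ℂ) : K w z = conj (K z w) := by
  rw [(hK z).2 _ (hK w).1, ← conj_innerProd, ← (hK w).2 _ (hK z).1]

/-- By symmetry this function is the entire function K(z, ·) conjugated on both sides. -/
theorem IsReproducingKernel.differentiable_conj {Δ : ℝ} {K : ℂ → ℂ → ℂ}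
    (hK : IsReproducingKernel Δ K) (z : ℂ) : Differentiable ℂ fun w => K (conj w) z := by
  intro w
  have h1 := ((hK z).1.1 (conj w)).conj_conj
  have h2 : (fun w => K (conj w) z) = conj ∘ K z ∘ conj := by
    ext w
    exact hK.conj_symm _ _
  rw [h2]
  simpa using h1

theorem IsReproducingKernel.tendsto_explicitKernel {Δ : ℝ} (hΔ1 : 1 < Δ) (hΔ2 : Δ ≤ 2)
    {K : ℂ → ℂ → ℂ} (hK : IsReproducingKernel Δ K) {w₀ : ℂ} (z : ℂ)
    (hw₀ : w₀ = 1 / (4 * π) ∨ w₀ = -1 / (4 * π)) :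
    Tendsto (fun w => explicitKernel Δ w z) (𝓝[≠] w₀) (𝓝 (K w₀ z)) := by
  have hpi : (π : ℂ) ≠ 0 := by exact_mod_cast Real.pi_ne_zero
  have hcont : Continuous fun w => K w z := by
    have h : (fun w => K w z) = fun w => conj (K z w) := funext fun w => hK.conj_symm w z
    rw [h]
    exact continuous_conj.comp (hK z).1.1.continuous
  refine ((hcont.tendsto w₀).mono_left nhdsWithin_le_nhds).congr' ?_
  have hne : w₀ ≠ -w₀ := by
    intro h
    have h0 : w₀ = 0 := by linear_combination (1 / 2 : ℂ) * h
    rcases hw₀ with h' | h' <;> simp [h', hpi] at h0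
  -- The other exceptional point is -w₀, so a punctured neighbourhood of w₀ that omits -w₀ consists
  -- of generic points.
  filter_upwards [self_mem_nhdsWithin,
    nhdsWithin_le_nhds (isOpen_ne.mem_nhds hne)] with w hw hw'
  have hneg : (-1 / (4 * π) : ℂ) = -(1 / (4 * π)) := by ring
  have h12 : w ≠ 1 / (4 * π) ∧ w ≠ -1 / (4 * π) := by
    rcases hw₀ with rfl | rfl
    · exact ⟨hw, by rwa [hneg]⟩
    · refine ⟨?_, hw⟩
      rw [hneg, neg_neg] at hw'
      exact hw'
  have hrep := explicitKernel_reproduces hΔ1 hΔ2 h12.1 h12.2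
  exact congrFun (hK.eq_of_reproduces hrep.1 hrep.2) z

end SpKernel

end

/-! ### The main theorem. -/

theorem theorem6 (Δ : ℝ) (hΔ0 : 0 < Δ) (hΔ2 : Δ ≤ 2) :
    ∃ K : ℂ → ℂ → ℂ,
      -- `K` is the unique reproducing kernel of the space
      (SpKernel.IsReproducingKernel Δ K ∧
        ∀ K' : ℂ → ℂ → ℂ, SpKernel.IsReproducingKernel Δ K' → K' = K) ∧
      -- part (i)
      (Δ ≤ 1 → ∀ w z : ℂ,
        K w z = SpKernel.sincFun Δ (z - conj w)
          + 1 / (2 - (Δ : ℂ)) * SpKernel.sincFun Δ z * SpKernel.sincFun Δ (conj w)) ∧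
      -- part (ii)
      (1 < Δ →
        SpKernel.det Δ ≠ 0 ∧
        (∀ w z : ℂ, w ≠ 1 / (4 * Real.pi) → w ≠ -1 / (4 * Real.pi) →
          K w z = SpKernel.explicitKernel Δ w z) ∧
        (∀ z : ℂ, Differentiable ℂ fun w : ℂ => K (conj w) z) ∧
        (∀ w₀ z : ℂ, (w₀ = 1 / (4 * Real.pi) ∨ w₀ = -1 / (4 * Real.pi)) →
          Filter.Tendsto (fun w : ℂ => SpKernel.explicitKernel Δ w z)
            (𝓝[≠] w₀) (𝓝 (K w₀ z)))) := by
  choose K hKmem hKrep using fun w : ℂ => SpKernel.exists_reproducing hΔ0 hΔ2 w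
  have hK : SpKernel.IsReproducingKernel Δ K := fun w => ⟨hKmem w, hKrep w⟩
  refine ⟨K, ⟨hK, fun K' hK' => ?_⟩, fun hΔ1 w z => ?_, fun hΔ1 => ⟨?_, ?_, ?_, ?_⟩⟩
  · ext1 w
    exact hK'.eq_of_reproduces (hK w).1 (hK w).2
  · have h := SpKernel.smallKernel_reproduces hΔ0 hΔ1 w
    exact congrFun (hK.eq_of_reproduces h.1 h.2) z
  · exact SpKernel.det_ne_zero hΔ1 hΔ2
  · intro w z h1 h2
    have h := SpKernel.explicitKernel_reproduces hΔ1 hΔ2 h1 h2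
    exact congrFun (hK.eq_of_reproduces h.1 h.2) z
  · exact hK.differentiable_conj
  · exact fun w₀ z hw₀ => hK.tendsto_explicitKernel hΔ1 hΔ2 z hw₀
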